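/- Let $E=(E^0,E^1,r,s)$ be an arbitrary directed graph (no restriction on the cardinalities of the vertex set $E^0$ and the edge set $E^1$), and let $k$ be a field with an involution $c\mapsto \bar c$, that is, a ring automorphism with $\bar{\bar c}=c$ (for instance the identity, or complex conjugation on $\mathbb{C}$). The Leavitt path algebra $L_k(E)$ is the universal associative (not necessarily unital) $k$-algebra generated by pairwise orthogonal idempotents $p_v$ ($v\in E^0$) and elements $s_e, s_e^*$ ($e\in E^1$) such that $p_{s(e)}s_e=s_e=s_ep_{r(e)}$ and $p_{r(e)}s_e^*=s_e^*=s_e^*p_{s(e)}$ for all $e \in E^1$, $s_e^*s_e=p_{r(e)}$ for all $e \in E^1$, $s_e^*s_f=0$ for all $e\neq f$ in $E^1$, and $p_v=\sum_{s(e)=v}s_es_e^*$ for every $v\in E^0$ with $0<|s^{-1}(v)|<\infty$. It is a $*$-algebra with the conjugate-linear involution that fixes every $p_v$ and interchanges $s_e$ and $s_e^*$. For a set $\Lambda$, let $M_\Lambda(k)$ denote the $*$-algebra of $\Lambda\times\Lambda$ matrices over $k$ with only finitely many nonzero entries, with involution $(a^*)_{ij}=\overline{a_{ji}}$. A representation of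 a $k$-algebra $A$ on a $k$-vector space $V$ is a $k$-algebra homomorphism $\rho:A\to\operatorname{End}_k(V)$ (not required to preserve units). It is irreducible if $\rho\neq 0$ and the only subspaces $W\subseteq V$ with $\rho(a)W\subseteq W$ for all $a\in A$ are $0$ and $V$. Two representations $\rho_1,\rho_2$ on $V_1,V_2$ are algebraically equivalent if there is a $k$-linear isomorphism $T:V_1\to V_2$ with $\rho_1(a)=T^{-1}\circ\rho_2(a)\circ T$ for all $a\in A$. If any two irreducible representations of $L_k(E)$ are algebraically equivalent, then there is a (possibly uncountable, possibly empty) set $\Lambda$ such that $L_k(E)\cong M_\Lambda(k)$ as $*$-algebras over $k$. -/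

import Mathlib

universe u v w x y

/-- A directed graph with vertex set `V`, edge set `E`, and range and source maps.
Nothing is assumed about the cardinalities of `V` and `E`. -/
structure DiGraph (V : Type u) (E : Type v) where
  r : E → V
  s : E → V

/-! ### Leavitt path algebras

The Leavitt path algebra is, in general, a non-unital algebra. It is built from its presentation:
formal expressions in the generators, modulo the axioms of an associative (non-unital) `k`-algebra
and the Leavitt path algebra relations. -/

/-- Formal non-unital `k`-algebra expressions in generators `p_v`, `s_e`, `s_e^*`. -/
inductive LeavittExpr (k : Type w) (V : Type u) (E : Type v) : Type (max u v w)
  | p (v : V) : LeavittExpr k V E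
  | s (e : E) : LeavittExpr k V E
  | sStar (e : E) : LeavittExpr k V E
  | zero : LeavittExpr k V E
  | add (a b : LeavittExpr k V E) : LeavittExpr k V E
  | mul (a b : LeavittExpr k V E) : LeavittExpr k V E
  | smul (c : k) (a : LeavittExpr k V E) : LeavittExpr k V E

namespace LeavittExpr

/-- The expression `∑ s_e s_e^*`, the sum being over a list of edges. -/
def sumRangeProj {k : Type w} {V : Type u} {E : Type v} (l : List E) : LeavittExpr k V E :=
  l.foldr (fun e t => add (mul (s e) (sStar e)) t) zero

/-- The formal adjoint of an expression. -/
def adj {k : Type w} [Star k] {V : Type u} {E : Type v} : LeavittExpr k V E → LeavittExpr k V E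
  | p v => p v
  | s e => sStar e
  | sStar e => s e
  | zero => zero
  | add a b => add (adj a) (adj b)
  | mul a b => mul (adj b) (adj a)
  | smul c a => smul (star c) (adj a)

theorem adj_sumRangeProj {k : Type w} [Star k] {V : Type u} {E : Type v} (l : List E) :
    adj (sumRangeProj l : LeavittExpr k V E) = sumRangeProj l := by
  induction l with
  | nil => rfl
  | cons e t ih =>
    change add (mul (s e) (sStar e)) (adj (sumRangeProj t)) = _
    rw [ih]; rfl

/-- The relations imposed on formal expressions. -/
inductive Rel (k : Type w) [Field k] {V : Type u} {E : Type v} (G : DiGraph V E) :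
    LeavittExpr k V E → LeavittExpr k V E → Prop
  -- compatibility with the operations
  | add_congr_left {a a' : LeavittExpr k V E} (b : LeavittExpr k V E) :
      Rel k G a a' → Rel k G (add a b) (add a' b)
  | add_congr_right (a : LeavittExpr k V E) {b b' : LeavittExpr k V E} :
      Rel k G b b' → Rel k G (add a b) (add a b')
  | mul_congr_left {a a' : LeavittExpr k V E} (b : LeavittExpr k V E) :
      Rel k G a a' → Rel k G (mul a b) (mul a' b)
  | mul_congr_right (a : LeavittExpr k V E) {b b' : LeavittExpr k V E} :
      Rel k G b b' → Rel k G (mul a b) (mul a b')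
  | smul_congr (c : k) {a a' : LeavittExpr k V E} :
      Rel k G a a' → Rel k G (smul c a) (smul c a')
  -- axioms of a `k`-vector space
  | add_assoc (a b c : LeavittExpr k V E) : Rel k G (add (add a b) c) (add a (add b c))
  | add_comm (a b : LeavittExpr k V E) : Rel k G (add a b) (add b a)
  | zero_add (a : LeavittExpr k V E) : Rel k G (add zero a) a
  | zero_smul (a : LeavittExpr k V E) : Rel k G (smul 0 a) zero
  | one_smul (a : LeavittExpr k V E) : Rel k G (smul 1 a) a
  | mul_smul (c d : k) (a : LeavittExpr k V E) : Rel k G (smul (c * d) a) (smul c (smul d a))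
  | smul_add (c : k) (a b : LeavittExpr k V E) :
      Rel k G (smul c (add a b)) (add (smul c a) (smul c b))
  | add_smul (c d : k) (a : LeavittExpr k V E) :
      Rel k G (smul (c + d) a) (add (smul c a) (smul d a))
  -- axioms of an associative `k`-algebra
  | mul_assoc (a b c : LeavittExpr k V E) : Rel k G (mul (mul a b) c) (mul a (mul b c))
  | left_distrib (a b c : LeavittExpr k V E) :
      Rel k G (mul a (add b c)) (add (mul a b) (mul a c))
  | right_distrib (a b c : LeavittExpr k V E) :
      Rel k G (mul (add a b) c) (add (mul a c) (mul b c))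
  | smul_mul (c : k) (a b : LeavittExpr k V E) : Rel k G (mul (smul c a) b) (smul c (mul a b))
  | mul_smul_comm (c : k) (a b : LeavittExpr k V E) :
      Rel k G (mul a (smul c b)) (smul c (mul a b))
  -- the `p_v` are pairwise orthogonal idempotents
  | p_mul_self (v : V) : Rel k G (mul (p v) (p v)) (p v)
  | p_mul_ne {v w : V} : v ≠ w → Rel k G (mul (p v) (p w)) zero
  -- `p_{s(e)} s_e = s_e = s_e p_{r(e)}`
  | p_mul_s (e : E) : Rel k G (mul (p (G.s e)) (s e)) (s e)
  | s_mul_p (e : E) : Rel k G (mul (s e) (p (G.r e))) (s e)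
  -- `p_{r(e)} s_e^* = s_e^* = s_e^* p_{s(e)}`
  | p_mul_sStar (e : E) : Rel k G (mul (p (G.r e)) (sStar e)) (sStar e)
  | sStar_mul_p (e : E) : Rel k G (mul (sStar e) (p (G.s e))) (sStar e)
  -- `s_e^* s_e = p_{r(e)}` and `s_e^* s_f = 0` for `e ≠ f`
  | sStar_mul_s (e : E) : Rel k G (mul (sStar e) (s e)) (p (G.r e))
  | sStar_mul_s_ne {e f : E} : e ≠ f → Rel k G (mul (sStar e) (s f)) zero
  -- `p_v = ∑_{s(e) = v} s_e s_e^*` whenever `0 < |s⁻¹(v)| < ∞`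
  | p_eq_sum (v : V) (F : Finset E) : F.Nonempty → (∀ e, e ∈ F ↔ G.s e = v) →
      Rel k G (p v) (sumRangeProj F.toList)

end LeavittExpr

/-- The Leavitt path algebra `L_k(G)`: the universal (non-unital) `k`-algebra generated by
elements `p_v`, `s_e`, `s_e^*` subject to the Leavitt path algebra relations. -/
def LeavittPathAlgebra (k : Type w) [Field k] {V : Type u} {E : Type v} (G : DiGraph V E) :
    Type (max u v w) :=
  Quot (LeavittExpr.Rel k G)

namespace LeavittPathAlgebra

variable {k : Type w} [Field k] {V : Type u} {E : Type v} {G : DiGraph V E}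

/-- The class of a formal expression. -/
def mk (a : LeavittExpr k V E) : LeavittPathAlgebra k G := Quot.mk _ a

/-- The generator `p_v`. -/
def p (v : V) : LeavittPathAlgebra k G := mk (.p v)

/-- The generator `s_e`. -/
def s (e : E) : LeavittPathAlgebra k G := mk (.s e)

/-- The generator `s_e^*`. -/
def sStar (e : E) : LeavittPathAlgebra k G := mk (.sStar e)

instance instZero : Zero (LeavittPathAlgebra k G) := ⟨mk .zero⟩

instance instAdd : Add (LeavittPathAlgebra k G) :=
  ⟨Quot.map₂ .add (fun a _ _ h => .add_congr_right a h) (fun _ _ b h => .add_congr_left b h)⟩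

instance instMul : Mul (LeavittPathAlgebra k G) :=
  ⟨Quot.map₂ .mul (fun a _ _ h => .mul_congr_right a h) (fun _ _ b h => .mul_congr_left b h)⟩

instance instSMul : SMul k (LeavittPathAlgebra k G) :=
  ⟨fun c => Quot.map (.smul c) (fun _ _ h => .smul_congr c h)⟩

instance instNeg : Neg (LeavittPathAlgebra k G) := ⟨fun a => (-1 : k) • a⟩

theorem zero_smul_aux (a : LeavittPathAlgebra k G) : (0 : k) • a = 0 := by
  induction a using Quot.ind; exact Quot.sound (.zero_smul _)

theorem smul_mul_aux (c : k) (a b : LeavittPathAlgebra k G) : (c • a) * b = c • (a * b) := by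
  induction a using Quot.ind; induction b using Quot.ind; exact Quot.sound (.smul_mul _ _ _)

theorem mul_smul_aux (c : k) (a b : LeavittPathAlgebra k G) : a * (c • b) = c • (a * b) := by
  induction a using Quot.ind; induction b using Quot.ind; exact Quot.sound (.mul_smul_comm _ _ _)

theorem one_smul_aux (a : LeavittPathAlgebra k G) : (1 : k) • a = a := by
  induction a using Quot.ind; exact Quot.sound (.one_smul _)

theorem add_smul_aux (c d : k) (a : LeavittPathAlgebra k G) : (c + d) • a = c • a + d • a := by
  induction a using Quot.ind; exact Quot.sound (.add_smul _ _ _)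

theorem mul_smul_assoc_aux (c d : k) (a : LeavittPathAlgebra k G) :
    (c * d) • a = c • (d • a) := by
  induction a using Quot.ind; exact Quot.sound (.mul_smul _ _ _)

theorem zero_add_aux (a : LeavittPathAlgebra k G) : 0 + a = a := by
  induction a using Quot.ind; exact Quot.sound (.zero_add _)

theorem add_comm_aux (a b : LeavittPathAlgebra k G) : a + b = b + a := by
  induction a using Quot.ind; induction b using Quot.ind; exact Quot.sound (.add_comm _ _)

instance instNonUnitalRing : NonUnitalRing (LeavittPathAlgebra k G) where
  add_assoc a b c := by
    induction a using Quot.ind; induction b using Quot.ind; induction c using Quot.ind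
    exact Quot.sound (.add_assoc _ _ _)
  add_comm := add_comm_aux
  zero_add := zero_add_aux
  add_zero a := by rw [add_comm_aux, zero_add_aux]
  nsmul := nsmulRec
  zsmul := zsmulRec
  neg_add_cancel a := by
    change (-1 : k) • a + a = 0
    conv_lhs => rw [← one_smul_aux a, ← mul_smul_assoc_aux, ← add_smul_aux]
    simp [zero_smul_aux]
  left_distrib a b c := by
    induction a using Quot.ind; induction b using Quot.ind; induction c using Quot.ind
    exact Quot.sound (.left_distrib _ _ _)
  right_distrib a b c := by
    induction a using Quot.ind; induction b using Quot.ind; induction c using Quot.ind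
    exact Quot.sound (.right_distrib _ _ _)
  zero_mul a := by
    rw [← zero_smul_aux (0 : LeavittPathAlgebra k G), smul_mul_aux, zero_smul_aux, zero_smul_aux]
  mul_zero a := by
    rw [← zero_smul_aux (0 : LeavittPathAlgebra k G), mul_smul_aux, zero_smul_aux, zero_smul_aux]
  mul_assoc a b c := by
    induction a using Quot.ind; induction b using Quot.ind; induction c using Quot.ind
    exact Quot.sound (.mul_assoc _ _ _)

instance instModule : Module k (LeavittPathAlgebra k G) where
  one_smul := one_smul_aux
  mul_smul := mul_smul_assoc_aux
  smul_zero c := by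
    rw [← zero_smul_aux (0 : LeavittPathAlgebra k G), ← mul_smul_assoc_aux, mul_zero]
  smul_add c a b := by
    induction a using Quot.ind; induction b using Quot.ind
    exact Quot.sound (.smul_add _ _ _)
  add_smul := add_smul_aux
  zero_smul := zero_smul_aux

instance instIsScalarTower : IsScalarTower k (LeavittPathAlgebra k G) (LeavittPathAlgebra k G) :=
  ⟨smul_mul_aux⟩

instance instSMulCommClass : SMulCommClass k (LeavittPathAlgebra k G) (LeavittPathAlgebra k G) :=
  ⟨fun c a b => (mul_smul_aux c a b).symm⟩

theorem mk_adj_eq [StarRing k] {a b : LeavittExpr k V E} (h : LeavittExpr.Rel k G a b) :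
    (mk a.adj : LeavittPathAlgebra k G) = mk b.adj := by
  induction h with
  | add_congr_left b _ ih => exact congrArg (· + (mk b.adj : LeavittPathAlgebra k G)) ih
  | add_congr_right a _ ih => exact congrArg ((mk a.adj : LeavittPathAlgebra k G) + ·) ih
  | mul_congr_left b _ ih => exact congrArg ((mk b.adj : LeavittPathAlgebra k G) * ·) ih
  | mul_congr_right a _ ih => exact congrArg (· * (mk a.adj : LeavittPathAlgebra k G)) ih
  | smul_congr c _ ih => exact congrArg (star c • ·) ih
  | add_assoc a b c => exact Quot.sound (.add_assoc _ _ _)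
  | add_comm a b => exact Quot.sound (.add_comm _ _)
  | zero_add a => exact Quot.sound (.zero_add _)
  | zero_smul a =>
    change star (0 : k) • (mk a.adj : LeavittPathAlgebra k G) = 0
    rw [star_zero, zero_smul]
  | one_smul a =>
    change star (1 : k) • (mk a.adj : LeavittPathAlgebra k G) = mk a.adj
    rw [star_one, one_smul]
  | mul_smul c d a =>
    change star (c * d) • (mk a.adj : LeavittPathAlgebra k G) = star c • star d • mk a.adj
    rw [star_mul', SemigroupAction.mul_smul]
  | smul_add c a b => exact Quot.sound (.smul_add _ _ _)
  | add_smul c d a =>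
    change star (c + d) • (mk a.adj : LeavittPathAlgebra k G) =
      star c • mk a.adj + star d • mk a.adj
    rw [star_add, add_smul]
  | mul_assoc a b c => exact (Quot.sound (.mul_assoc _ _ _)).symm
  | left_distrib a b c => exact Quot.sound (.right_distrib _ _ _)
  | right_distrib a b c => exact Quot.sound (.left_distrib _ _ _)
  | smul_mul c a b => exact Quot.sound (.mul_smul_comm _ _ _)
  | mul_smul_comm c a b => exact Quot.sound (.smul_mul _ _ _)
  | p_mul_self v => exact Quot.sound (.p_mul_self _)
  | p_mul_ne h => exact Quot.sound (.p_mul_ne h.symm)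
  | p_mul_s e => exact Quot.sound (.sStar_mul_p _)
  | s_mul_p e => exact Quot.sound (.p_mul_sStar _)
  | p_mul_sStar e => exact Quot.sound (.s_mul_p _)
  | sStar_mul_p e => exact Quot.sound (.p_mul_s _)
  | sStar_mul_s e => exact Quot.sound (.sStar_mul_s _)
  | sStar_mul_s_ne h => exact Quot.sound (.sStar_mul_s_ne h.symm)
  | p_eq_sum v F h h' =>
    rw [LeavittExpr.adj_sumRangeProj]
    exact Quot.sound (.p_eq_sum v F h h')

/-- The involution of `L_k(G)`: the conjugate-linear anti-automorphism that fixes every `p_v` and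
interchanges `s_e` and `s_e^*`. -/
instance instStarRing [StarRing k] : StarRing (LeavittPathAlgebra k G) where
  star := Quot.lift (fun a => mk a.adj) (fun _ _ h => mk_adj_eq h)
  star_involutive a := by
    induction a using Quot.ind with
    | mk a =>
      change (mk a.adj.adj : LeavittPathAlgebra k G) = mk a
      congr 1
      induction a with
      | p v => rfl
      | s e => rfl
      | sStar e => rfl
      | zero => rfl
      | add a b iha ihb => simp only [LeavittExpr.adj, iha, ihb]
      | mul a b iha ihb => simp only [LeavittExpr.adj, iha, ihb]
      | smul c a ih => simp only [LeavittExpr.adj, ih, star_star]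
  star_mul a b := by
    induction a using Quot.ind; induction b using Quot.ind; rfl
  star_add a b := by
    induction a using Quot.ind; induction b using Quot.ind; rfl

instance instStarModule [StarRing k] : StarModule k (LeavittPathAlgebra k G) :=
  ⟨fun c a => by induction a using Quot.ind; rfl⟩

end LeavittPathAlgebra

/-! ### Finitely supported matrices -/

/-- `M_Λ(k)`: the `Λ × Λ` matrices with entries in `k`, only finitely many of them nonzero. -/
def FinSuppMatrix (Λ : Type x) (k : Type w) [Field k] : Type (max x w) := Λ × Λ →₀ k

namespace FinSuppMatrix

variable {Λ : Type x} {k : Type w} [Field k]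

noncomputable instance instAddCommGroup : AddCommGroup (FinSuppMatrix Λ k) :=
  inferInstanceAs (AddCommGroup (Λ × Λ →₀ k))

noncomputable instance instModule : Module k (FinSuppMatrix Λ k) :=
  inferInstanceAs (Module k (Λ × Λ →₀ k))

/-- The entry in row `i` and column `j`. -/
def entry (a : FinSuppMatrix Λ k) (i j : Λ) : k := Finsupp.toFun a (i, j)

@[ext]
theorem ext {a b : FinSuppMatrix Λ k} (h : ∀ i j, a.entry i j = b.entry i j) : a = b :=
  Finsupp.ext fun q => h q.1 q.2

theorem finite_support (a : FinSuppMatrix Λ k) : {q : Λ × Λ | a.entry q.1 q.2 ≠ 0}.Finite := by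
  refine (Finsupp.support a).finite_toSet.subset fun q hq => ?_
  exact Finsupp.mem_support_iff.2 hq

/-- The matrix with given entries, finitely many of them nonzero. -/
noncomputable def ofEntries (f : Λ → Λ → k) (hf : {q : Λ × Λ | f q.1 q.2 ≠ 0}.Finite) :
    FinSuppMatrix Λ k :=
  Finsupp.onFinset hf.toFinset (fun q => f q.1 q.2) fun q hq => by simpa using hq

@[simp]
theorem entry_ofEntries (f : Λ → Λ → k) (hf) (i j : Λ) : (ofEntries f hf).entry i j = f i j := rfl

@[simp]
theorem entry_zero (i j : Λ) : (0 : FinSuppMatrix Λ k).entry i j = 0 := rfl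

@[simp]
theorem entry_add (a b : FinSuppMatrix Λ k) (i j : Λ) :
    (a + b).entry i j = a.entry i j + b.entry i j := rfl

@[simp]
theorem entry_smul (c : k) (a : FinSuppMatrix Λ k) (i j : Λ) :
    (c • a).entry i j = c * a.entry i j := rfl

theorem finite_row (a : FinSuppMatrix Λ k) (i : Λ) :
    (Function.support fun l => a.entry i l).Finite :=
  (a.finite_support.image Prod.snd).subset fun l hl => ⟨(i, l), hl, rfl⟩

theorem finite_row_mul (a : FinSuppMatrix Λ k) (i : Λ) (f : Λ → k) :
    (Function.support fun l => a.entry i l * f l).Finite :=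
  (a.finite_row i).subset fun _ hl => left_ne_zero_of_mul hl

theorem finite_col (b : FinSuppMatrix Λ k) (j : Λ) :
    (Function.support fun l => b.entry l j).Finite :=
  (b.finite_support.image Prod.fst).subset fun l hl => ⟨(l, j), hl, rfl⟩

theorem finite_mul_col (b : FinSuppMatrix Λ k) (j : Λ) (f : Λ → k) :
    (Function.support fun l => f l * b.entry l j).Finite :=
  (b.finite_col j).subset fun _ hl => right_ne_zero_of_mul hl

theorem finite_support_mul (a b : FinSuppMatrix Λ k) :
    {q : Λ × Λ | ∑ᶠ l, a.entry q.1 l * b.entry l q.2 ≠ 0}.Finite := by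
  refine ((a.finite_support.image Prod.fst).prod (b.finite_support.image Prod.snd)).subset ?_
  rintro ⟨i, j⟩ h
  obtain ⟨l, hl⟩ : ∃ l, a.entry i l * b.entry l j ≠ 0 := by
    by_contra hc
    exact h (finsum_eq_zero_of_forall_eq_zero fun l => not_not.1 (not_exists.1 hc l))
  exact ⟨⟨(i, l), left_ne_zero_of_mul hl, rfl⟩, ⟨(l, j), right_ne_zero_of_mul hl, rfl⟩⟩

/-- Matrix multiplication: `(a b)_{ij} = ∑_l a_{il} b_{lj}`. -/
noncomputable instance instMul : Mul (FinSuppMatrix Λ k) :=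
  ⟨fun a b => ofEntries (fun i j => ∑ᶠ l, a.entry i l * b.entry l j) (finite_support_mul a b)⟩

theorem entry_mul (a b : FinSuppMatrix Λ k) (i j : Λ) :
    (a * b).entry i j = ∑ᶠ l, a.entry i l * b.entry l j := rfl

theorem entry_mul_of_subset (a b : FinSuppMatrix Λ k) (i j : Λ) (F : Finset Λ)
    (hF : (Function.support fun l => a.entry i l * b.entry l j) ⊆ F) :
    (a * b).entry i j = ∑ l ∈ F, a.entry i l * b.entry l j := by
  rw [entry_mul, finsum_eq_sum_of_support_subset _ hF]

noncomputable instance instNonUnitalRing : NonUnitalRing (FinSuppMatrix Λ k) where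
  __ := instAddCommGroup (Λ := Λ) (k := k)
  left_distrib a b c := by
    ext i j
    simp only [entry_mul, entry_add, mul_add]
    exact finsum_add_distrib (a.finite_row_mul i _) (a.finite_row_mul i _)
  right_distrib a b c := by
    ext i j
    simp only [entry_mul, entry_add, add_mul]
    exact finsum_add_distrib (a.finite_row_mul i _) (b.finite_row_mul i _)
  zero_mul a := by ext i j; simp [entry_mul]
  mul_zero a := by ext i j; simp [entry_mul]
  mul_assoc a b c := by
    ext i j
    have h1 : ∀ m, (a * b).entry i m =
        ∑ l ∈ (a.finite_row i).toFinset, a.entry i l * b.entry l m := fun m =>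
      entry_mul_of_subset _ _ _ _ _ fun l hl => by
        simpa using left_ne_zero_of_mul hl
    have h2 : ∀ l, (b * c).entry l j =
        ∑ m ∈ (c.finite_col j).toFinset, b.entry l m * c.entry m j := fun l =>
      entry_mul_of_subset _ _ _ _ _ fun m hm => by
        simpa using right_ne_zero_of_mul hm
    rw [entry_mul_of_subset (a * b) c i j (c.finite_col j).toFinset
        (fun m hm => by simpa using right_ne_zero_of_mul hm),
      entry_mul_of_subset a (b * c) i j (a.finite_row i).toFinset
        (fun m hm => by simpa using left_ne_zero_of_mul hm)]
    simp only [h1, h2, Finset.sum_mul, Finset.mul_sum, mul_assoc]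
    exact Finset.sum_comm

instance instIsScalarTower : IsScalarTower k (FinSuppMatrix Λ k) (FinSuppMatrix Λ k) :=
  ⟨fun c a b => by
    ext i j
    simp only [smul_eq_mul, entry_mul, entry_smul, mul_assoc, mul_finsum]⟩

instance instSMulCommClass : SMulCommClass k (FinSuppMatrix Λ k) (FinSuppMatrix Λ k) :=
  ⟨fun c a b => by
    ext i j
    simp only [smul_eq_mul, entry_mul, entry_smul, mul_left_comm, mul_finsum]⟩

/-- The involution of `M_Λ(k)`: the conjugate transpose, `(a^*)_{ij} = (a_{ji})^*`. -/
noncomputable instance instStarRing [StarRing k] : StarRing (FinSuppMatrix Λ k) where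
  star a := ofEntries (fun i j => star (a.entry j i)) <| by
    refine (a.finite_support.image Prod.swap).subset fun q hq => ?_
    exact ⟨q.swap, by simpa using hq, Prod.swap_swap q⟩
  star_involutive a := by ext i j; simp
  star_mul a b := by
    ext i j
    simp only [entry_ofEntries, entry_mul]
    rw [finsum_eq_sum_of_support_subset (s := (a.finite_row j).toFinset) _
        (fun l hl => by simpa using left_ne_zero_of_mul hl), star_sum,
      finsum_eq_sum_of_support_subset (s := (a.finite_row j).toFinset) _
        (fun l hl => by simpa using right_ne_zero_of_mul hl)]
    simp only [star_mul]
  star_add a b := by ext i j; simp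

theorem entry_star [StarRing k] (a : FinSuppMatrix Λ k) (i j : Λ) :
    (star a).entry i j = star (a.entry j i) := rfl

instance instStarModule [StarRing k] : StarModule k (FinSuppMatrix Λ k) :=
  ⟨fun c a => by ext i j; simp [entry_star]⟩

end FinSuppMatrix

/-! ### Representations -/

/-- A representation `ρ : A → End_k(V)` of a (possibly non-unital) `k`-algebra is irreducible when
it is nonzero and the only `ρ`-invariant subspaces of `V` are `0` and `V`. -/
def IsIrreducibleRep {k : Type w} [Field k] {A : Type x} [NonUnitalRing A] [Module k A]
    {V : Type y} [AddCommGroup V] [Module k V] (ρ : A →ₙₐ[k] Module.End k V) : Prop :=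
  ρ ≠ 0 ∧ ∀ W : Submodule k V, (∀ a : A, ∀ v ∈ W, ρ a v ∈ W) → W = ⊥ ∨ W = ⊤

/-- Representations `ρ₁`, `ρ₂` are algebraically equivalent when `ρ₁(a) = T⁻¹ ∘ ρ₂(a) ∘ T` for all
`a`, for some `k`-linear isomorphism `T : V₁ → V₂`. -/
def AlgebraicallyEquivalent {k : Type w} [Field k] {A : Type x} [NonUnitalRing A] [Module k A]
    {V₁ : Type y} [AddCommGroup V₁] [Module k V₁] {V₂ : Type y} [AddCommGroup V₂] [Module k V₂]
    (ρ₁ : A →ₙₐ[k] Module.End k V₁) (ρ₂ : A →ₙₐ[k] Module.End k V₂) : Prop :=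
  ∃ T : V₁ ≃ₗ[k] V₂, ∀ a : A,
    ρ₁ a = (T.symm : V₂ →ₗ[k] V₁) ∘ₗ ρ₂ a ∘ₗ (T : V₁ →ₗ[k] V₂)

/-!
A boundary path is an infinite path, or a finite path that ends at a singular vertex (a sink or an
infinite emitter). `L_k(G)` acts on the space spanned by the boundary paths (`pathRep`): `s_e` puts
the edge `e` in front, `s_e^*` removes it. The action may be twisted by a scalar `A` of an extension
field, every edge then contributing a factor `A`.

Every vector `ξ` of a representation has a counterpart with the same relations in some irreducible
representation, namely in a quotient of the unitization by a maximal left ideal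
(`exists_irreducibleRep_of_vector`). If there is only one irreducible representation, it contains
counterparts of all basis vectors of all these path representations, and one is mapped to another
by an element of the algebra. Comparing two boundary paths, which are separated by elements acting
as projections, shows that any two of them are tail equivalent (`tailEquiv_of_unique`). Comparing a
periodic infinite path with itself in a twisted representation gives a contradiction, so that `G`
has no closed paths (`drop_ne_self_of_unique`). An infinite emitter would lie on a closed path, so
singular vertices are sinks.

Fix a boundary path `b₀`. By tail equivalence the countably many closed sets
`{b | b.drop m = b₀.drop n}` cover the space of boundary paths, so by Baire's theorem one of them
has interior, which gives a vertex `w` from which only one boundary path `ω` starts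
(`exists_forall_src_eq`). Tail equivalence with `ω` also makes the edge relation well founded away
from `ω`, whence the two-sided ideal generated by `p_w` is the whole algebra (`mem_of_p_mem`).

The matrix of an element in the untwisted representation on boundary paths is compatible with the
involution. That of `p_w` is a matrix unit, so all these matrices are finitely supported, and all
matrix units occur. Finally, the representation on boundary paths embeds into the left ideal
`L_k(G) p_w` with `ω` sent to `p_w` (`exists_intertwiner`). An element acting as zero therefore
annihilates `L_k(G) p_w`, hence the ideal generated by `p_w`, hence everything, and is zero. So the
matrices identify `L_k(G)` with the finitely supported matrices indexed by the boundary paths.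
-/

/-! ### Relations, induction and the universal property -/

namespace LeavittPathAlgebra

variable {k : Type w} [Field k] {V : Type u} {E : Type v} {G : DiGraph V E}

theorem p_mul_self (v : V) : (p v * p v : LeavittPathAlgebra k G) = p v :=
  Quot.sound (.p_mul_self v)

theorem p_mul_p_of_ne {v v' : V} (h : v ≠ v') : (p v * p v' : LeavittPathAlgebra k G) = 0 :=
  Quot.sound (.p_mul_ne h)

theorem p_mul_s (e : E) : (p (G.s e) * s e : LeavittPathAlgebra k G) = s e :=
  Quot.sound (.p_mul_s e)

theorem s_mul_p (e : E) : (s e * p (G.r e) : LeavittPathAlgebra k G) = s e :=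
  Quot.sound (.s_mul_p e)

theorem p_mul_sStar (e : E) : (p (G.r e) * sStar e : LeavittPathAlgebra k G) = sStar e :=
  Quot.sound (.p_mul_sStar e)

theorem sStar_mul_p (e : E) : (sStar e * p (G.s e) : LeavittPathAlgebra k G) = sStar e :=
  Quot.sound (.sStar_mul_p e)

theorem sStar_mul_s (e : E) : (sStar e * s e : LeavittPathAlgebra k G) = p (G.r e) :=
  Quot.sound (.sStar_mul_s e)

theorem sStar_mul_s_of_ne {e f : E} (h : e ≠ f) : (sStar e * s f : LeavittPathAlgebra k G) = 0 :=
  Quot.sound (.sStar_mul_s_ne h)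

theorem mk_sumRangeProj (l : List E) :
    (mk (LeavittExpr.sumRangeProj l) : LeavittPathAlgebra k G) =
      (l.map fun e => s e * sStar e).sum := by
  induction l with
  | nil => rfl
  | cons e t ih => rw [List.map_cons, List.sum_cons, ← ih]; rfl

theorem p_eq_sum {v : V} {F : Finset E} (hF : F.Nonempty) (h : ∀ e, e ∈ F ↔ G.s e = v) :
    (p v : LeavittPathAlgebra k G) = ∑ e ∈ F, s e * sStar e := by
  rw [← Finset.sum_map_toList, ← mk_sumRangeProj]
  exact Quot.sound (.p_eq_sum v F hF h)

@[simp]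
theorem star_p [StarRing k] (v : V) : star (p v : LeavittPathAlgebra k G) = p v := rfl

@[simp]
theorem star_s [StarRing k] (e : E) : star (s e : LeavittPathAlgebra k G) = sStar e := rfl

@[simp]
theorem star_sStar [StarRing k] (e : E) : star (sStar e : LeavittPathAlgebra k G) = s e := rfl

theorem induction {P : LeavittPathAlgebra k G → Prop} (hp : ∀ v, P (p v)) (hs : ∀ e, P (s e))
    (hsStar : ∀ e, P (sStar e)) (hzero : P 0) (hadd : ∀ a b, P a → P b → P (a + b))
    (hmul : ∀ a b, P a → P b → P (a * b)) (hsmul : ∀ (c : k) a, P a → P (c • a))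
    (a : LeavittPathAlgebra k G) : P a := by
  induction a using Quot.ind with
  | mk a =>
    induction a with
    | p v => exact hp v
    | s e => exact hs e
    | sStar e => exact hsStar e
    | zero => exact hzero
    | add a b iha ihb => exact hadd _ _ iha ihb
    | mul a b iha ihb => exact hmul _ _ iha ihb
    | smul c a ih => exact hsmul c _ ih

/-- The universal property: elements of a `k`-algebra `R` that satisfy the Leavitt path algebra
relations define a homomorphism from `L_k(G)`. -/
theorem exists_lift {R : Type y} [Ring R] [Algebra k R] (P : V → R) (S T : E → R)
    (hPP : ∀ v, P v * P v = P v) (hPP' : ∀ v v', v ≠ v' → P v * P v' = 0)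
    (hPS : ∀ e, P (G.s e) * S e = S e) (hSP : ∀ e, S e * P (G.r e) = S e)
    (hPT : ∀ e, P (G.r e) * T e = T e) (hTP : ∀ e, T e * P (G.s e) = T e)
    (hTS : ∀ e, T e * S e = P (G.r e)) (hTS' : ∀ e f, e ≠ f → T e * S f = 0)
    (hsum : ∀ (v : V) (F : Finset E), F.Nonempty → (∀ e, e ∈ F ↔ G.s e = v) →
      P v = ∑ e ∈ F, S e * T e) :
    ∃ ρ : LeavittPathAlgebra k G →ₙₐ[k] R,
      (∀ v, ρ (p v) = P v) ∧ (∀ e, ρ (s e) = S e) ∧ ∀ e, ρ (sStar e) = T e := by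
  let ev : LeavittExpr k V E → R := fun a =>
    LeavittExpr.rec (motive := fun _ => R) P S T 0 (fun _ _ x y => x + y) (fun _ _ x y => x * y)
      (fun c _ x => c • x) a
  have ev_sum : ∀ l : List E, ev (LeavittExpr.sumRangeProj l) = (l.map fun e => S e * T e).sum := by
    intro l
    induction l with
    | nil => rfl
    | cons e t ih => rw [List.map_cons, List.sum_cons, ← ih]; rfl
  have ev_rel : ∀ a b, LeavittExpr.Rel k G a b → ev a = ev b := by
    intro a b hab
    induction hab with
    | add_congr_left b _ ih => exact congrArg (· + ev b) ih
    | add_congr_right a _ ih => exact congrArg (ev a + ·) ih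
    | mul_congr_left b _ ih => exact congrArg (· * ev b) ih
    | mul_congr_right a _ ih => exact congrArg (ev a * ·) ih
    | smul_congr c _ ih => exact congrArg (c • ·) ih
    | add_assoc a b c => exact _root_.add_assoc (ev a) (ev b) (ev c)
    | add_comm a b => exact _root_.add_comm (ev a) (ev b)
    | zero_add a => exact _root_.zero_add (ev a)
    | zero_smul a => exact _root_.zero_smul k (ev a)
    | one_smul a => exact _root_.one_smul k (ev a)
    | mul_smul c d a => exact SemigroupAction.mul_smul c d (ev a)
    | smul_add c a b => exact _root_.smul_add c (ev a) (ev b)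
    | add_smul c d a => exact _root_.add_smul c d (ev a)
    | mul_assoc a b c => exact _root_.mul_assoc (ev a) (ev b) (ev c)
    | left_distrib a b c => exact mul_add (ev a) (ev b) (ev c)
    | right_distrib a b c => exact add_mul (ev a) (ev b) (ev c)
    | smul_mul c a b => exact smul_mul_assoc c (ev a) (ev b)
    | mul_smul_comm c a b => exact _root_.mul_smul_comm c (ev a) (ev b)
    | p_mul_self v => exact hPP v
    | p_mul_ne h => exact hPP' _ _ h
    | p_mul_s e => exact hPS e
    | s_mul_p e => exact hSP e
    | p_mul_sStar e => exact hPT e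
    | sStar_mul_p e => exact hTP e
    | sStar_mul_s e => exact hTS e
    | sStar_mul_s_ne h => exact hTS' _ _ h
    | p_eq_sum v F h h' =>
      rw [ev_sum, Finset.sum_map_toList]
      exact hsum v F h h'
  refine ⟨{ toFun := Quot.lift ev ev_rel
            map_smul' := ?_
            map_zero' := rfl
            map_add' := ?_
            map_mul' := ?_ }, fun _ => rfl, fun _ => rfl, fun _ => rfl⟩
  · intro c a; induction a using Quot.ind; rfl
  · intro a b; induction a using Quot.ind; induction b using Quot.ind; rfl
  · intro a b; induction a using Quot.ind; induction b using Quot.ind; rfl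

/-- `L_k(G)` has local units: finite sums of the `p_v`. -/
theorem exists_mul_sum_p_eq (a : LeavittPathAlgebra k G) :
    ∃ F : Finset V, ∀ F', F ⊆ F' → a * ∑ v ∈ F', p v = a := by
  classical
  have key : ∀ (a : LeavittPathAlgebra k G) (v : V), a * p v = a →
      ∃ F : Finset V, ∀ F', F ⊆ F' → a * ∑ v ∈ F', p v = a := by
    intro a v hav
    refine ⟨{v}, fun F' hF' => ?_⟩
    rw [← hav, mul_assoc, Finset.mul_sum, Finset.sum_eq_single v, p_mul_self]
    · exact fun b _ hb => p_mul_p_of_ne hb.symm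
    · exact fun hv => absurd (hF' (Finset.mem_singleton_self v)) hv
  induction a using LeavittPathAlgebra.induction with
  | hp v => exact key _ v (p_mul_self v)
  | hs e => exact key _ _ (s_mul_p e)
  | hsStar e => exact key _ _ (sStar_mul_p e)
  | hzero => exact ⟨∅, fun F' _ => zero_mul _⟩
  | hadd a b iha ihb =>
    obtain ⟨F₁, h₁⟩ := iha
    obtain ⟨F₂, h₂⟩ := ihb
    refine ⟨F₁ ∪ F₂, fun F' hF' => ?_⟩
    rw [add_mul, h₁ _ (Finset.union_subset_left hF'), h₂ _ (Finset.union_subset_right hF')]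
  | hmul a b _ ihb =>
    obtain ⟨F₂, h₂⟩ := ihb
    exact ⟨F₂, fun F' hF' => by rw [mul_assoc, h₂ _ hF']⟩
  | hsmul c a ih =>
    obtain ⟨F₁, h₁⟩ := ih
    exact ⟨F₁, fun F' hF' => by rw [smul_mul_assoc, h₁ _ hF']⟩

theorem eq_zero_of_mul_eq_zero {a : LeavittPathAlgebra k G} (h : ∀ b, a * b = 0) : a = 0 := by
  obtain ⟨F, hF⟩ := exists_mul_sum_p_eq a
  rw [← hF F subset_rfl, h]

end LeavittPathAlgebra

/-! ### Irreducible representations with prescribed relations -/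

section Irreducible

variable {k : Type w} [Field k] {A : Type x} [NonUnitalRing A] [Module k A]

variable (k A) in
/-- Any two irreducible representations of the `k`-algebra `A` are algebraically equivalent. -/
def HasUniqueIrreducibleRep : Prop :=
  ∀ (S₁ S₂ : Type (max x w)) [AddCommGroup S₁] [Module k S₁] [AddCommGroup S₂] [Module k S₂]
    (σ₁ : A →ₙₐ[k] Module.End k S₁) (σ₂ : A →ₙₐ[k] Module.End k S₂),
    IsIrreducibleRep σ₁ → IsIrreducibleRep σ₂ → AlgebraicallyEquivalent σ₁ σ₂

theorem IsIrreducibleRep.exists_apply_eq {S : Type y} [AddCommGroup S] [Module k S]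
    {σ : A →ₙₐ[k] Module.End k S} (hσ : IsIrreducibleRep σ) {u : A} {η : S} (hη : η ≠ 0)
    (hu : σ u η = η) (ζ : S) : ∃ a, σ a η = ζ := by
  let W : Submodule k S :=
    { carrier := {ζ | ∃ a, σ a η = ζ}
      add_mem' := by
        rintro _ _ ⟨a, rfl⟩ ⟨b, rfl⟩
        exact ⟨a + b, by rw [map_add, LinearMap.add_apply]⟩
      zero_mem' := ⟨0, by rw [map_zero, LinearMap.zero_apply]⟩
      smul_mem' := by
        rintro c _ ⟨a, rfl⟩
        exact ⟨c • a, by rw [map_smul, LinearMap.smul_apply]⟩ }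
  have hW : W = ⊤ := by
    refine (hσ.2 W ?_).resolve_left fun h0 => hη ?_
    · rintro a _ ⟨b, rfl⟩
      exact ⟨a * b, by rw [map_mul, Module.End.mul_apply]⟩
    · rw [← Submodule.mem_bot k, ← h0]
      exact ⟨u, hu⟩
  have : ζ ∈ W := hW ▸ Submodule.mem_top
  exact this

variable [IsScalarTower k A A] [SMulCommClass k A A]

/-- A nonzero vector `ξ` of a representation that is fixed by some element of the algebra has a
nonzero counterpart `η` in an irreducible representation that satisfies all relations of `ξ`. The
irreducible representation is the quotient of the unitization by a maximal left ideal containing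
the annihilator of `ξ`. -/
theorem exists_irreducibleRep_of_vector {M : Type y} [AddCommGroup M] [Module k M]
    (ρ : A →ₙₐ[k] Module.End k M) {ξ : M} (hξ : ξ ≠ 0) {u : A} (hu : ρ u ξ = ξ) :
    ∃ (S : Type (max x w)) (_ : AddCommGroup S) (_ : Module k S) (σ : A →ₙₐ[k] Module.End k S)
      (η : S), IsIrreducibleRep σ ∧ η ≠ 0 ∧ ∀ x (c : k), ρ x ξ = c • ξ → σ x η = c • η := by
  let ρ' : Unitization k A →ₐ[k] Module.End k M := Unitization.lift ρ
  have hρ' : ∀ (c : k) (a : A), ρ' (Unitization.inl c + (a : Unitization k A)) =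
      c • LinearMap.id + ρ a := by
    intro c a
    ext v
    simp [ρ', Algebra.algebraMap_eq_smul_one]
  let I : Ideal (Unitization k A) :=
    { carrier := {x | ρ' x ξ = 0}
      add_mem' := fun {x y} hx hy => by
        simp only [Set.mem_ofPred_eq] at hx hy ⊢
        rw [map_add, LinearMap.add_apply, hx, hy, add_zero]
      zero_mem' := by simp
      smul_mem' := fun x y hy => by
        simp only [Set.mem_ofPred_eq, smul_eq_mul] at hy ⊢
        rw [map_mul, Module.End.mul_apply, hy, map_zero] }
  have hI : I ≠ ⊤ := fun h => hξ <| by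
    have : (1 : Unitization k A) ∈ I := h ▸ Submodule.mem_top
    simpa [I] using this
  obtain ⟨m, hm, hIm⟩ := Ideal.exists_le_maximal I hI
  let S := Unitization k A ⧸ (m : Submodule (Unitization k A) (Unitization k A))
  let π : Unitization k A →ₗ[Unitization k A] S := Submodule.mkQ m
  have hπ : ∀ x, π x = 0 ↔ x ∈ m := fun x => Submodule.Quotient.mk_eq_zero m
  let σ : A →ₙₐ[k] Module.End k S :=
    ((Algebra.lsmul k k S : Unitization k A →ₐ[k] Module.End k S) :
      Unitization k A →ₙₐ[k] Module.End k S).comp (Unitization.inrNonUnitalAlgHom k A)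
  have hσ : ∀ a (ζ : S), σ a ζ = (a : Unitization k A) • ζ := fun a ζ => rfl
  have hη : π 1 ≠ 0 := fun h => hm.ne_top ((Ideal.eq_top_iff_one m).2 ((hπ 1).1 h))
  have hrel : ∀ x (c : k), ρ x ξ = c • ξ → σ x (π 1) = c • π 1 := by
    intro x c hx
    have h1 : Unitization.inl (-c) + (x : Unitization k A) ∈ m := by
      refine hIm ?_
      change ρ' _ ξ = 0
      rw [hρ', LinearMap.add_apply, hx]
      simp
    rw [← hπ] at h1
    have h2 : Unitization.inl (-c) + (x : Unitization k A) =
        (x : Unitization k A) • 1 - c • 1 := by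
      have hc : (c • 1 : Unitization k A) = Unitization.inl c := by ext <;> simp
      rw [smul_eq_mul, mul_one, hc, Unitization.inl_neg, neg_add_eq_sub]
    rw [h2, map_sub, map_smul, sub_eq_zero] at h1
    rw [hσ, h1]
    rfl
  refine ⟨S, inferInstance, inferInstance, σ, π 1, ⟨?_, ?_⟩, hη, hrel⟩
  · intro h0
    have := hrel u 1 (by rw [hu, one_smul])
    rw [h0] at this
    exact hη ((one_smul k (π 1)).symm.trans this.symm)
  · intro W hW
    let m' : Ideal (Unitization k A) :=
      { carrier := {x | π x ∈ W}
        add_mem' := fun {x y} hx hy => by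
          simp only [Set.mem_ofPred_eq] at hx hy ⊢
          rw [map_add]
          exact W.add_mem hx hy
        zero_mem' := by simp
        smul_mem' := fun x y hy => by
          simp only [Set.mem_ofPred_eq] at hy ⊢
          induction x with
          | inl_add_inr c a =>
            rw [add_smul, map_add, map_smul π (a : Unitization k A)]
            refine W.add_mem ?_ (hW a _ hy)
            have : (Unitization.inl c : Unitization k A) • y = c • y := by
              ext <;> simp
            rw [this]
            exact W.smul_mem c hy }
    have hmm' : m ≤ m' := fun x hx => by
      change π x ∈ W
      rw [(hπ x).2 hx]
      exact W.zero_mem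
    rcases hm.out.le_iff.1 hmm' with h | h
    · right
      refine eq_top_iff.2 fun ζ _ => ?_
      obtain ⟨x, rfl⟩ := Submodule.mkQ_surjective m ζ
      have : x ∈ m' := h ▸ Submodule.mem_top
      exact this
    · left
      refine eq_bot_iff.2 fun ζ hζ => ?_
      obtain ⟨x, rfl⟩ := Submodule.mkQ_surjective m ζ
      have : x ∈ m' := hζ
      rw [h] at this
      exact (hπ x).2 this

/-- If all irreducible representations of `A` are equivalent, then for any two vectors `ξ₁`, `ξ₂`
of representations some left ideal `m` containing the annihilator of `ξ₁` and some
`a ∉ m` exist such that the class of `a` modulo `m` satisfies all relations of `ξ₂`. -/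
theorem exists_leftIdeal_of_equivalent
    (h : HasUniqueIrreducibleRep k A)
    {M₁ : Type y} [AddCommGroup M₁] [Module k M₁] {M₂ : Type y} [AddCommGroup M₂] [Module k M₂]
    (ρ₁ : A →ₙₐ[k] Module.End k M₁) {ξ₁ : M₁} (hξ₁ : ξ₁ ≠ 0) {u₁ : A} (hu₁ : ρ₁ u₁ ξ₁ = ξ₁)
    (ρ₂ : A →ₙₐ[k] Module.End k M₂) {ξ₂ : M₂} (hξ₂ : ξ₂ ≠ 0) {u₂ : A} (hu₂ : ρ₂ u₂ ξ₂ = ξ₂) :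
    ∃ m : Submodule k A, (∀ x y, y ∈ m → x * y ∈ m) ∧ (∀ x, ρ₁ x ξ₁ = 0 → x ∈ m) ∧
      ∃ a, a ∉ m ∧ ∀ x (c : k), ρ₂ x ξ₂ = c • ξ₂ → x * a - c • a ∈ m := by
  obtain ⟨S₁, _, _, σ₁, η₁, hσ₁, hη₁, h₁⟩ := exists_irreducibleRep_of_vector ρ₁ hξ₁ hu₁
  obtain ⟨S₂, _, _, σ₂, η₂, hσ₂, hη₂, h₂⟩ := exists_irreducibleRep_of_vector ρ₂ hξ₂ hu₂
  obtain ⟨T, hT⟩ := h S₂ S₁ σ₂ σ₁ hσ₂ hσ₁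
  obtain ⟨a, ha⟩ := hσ₁.exists_apply_eq hη₁
    (by simpa using h₁ u₁ 1 (by rw [hu₁, one_smul])) (T η₂)
  refine ⟨{ carrier := {x | σ₁ x η₁ = 0}
            add_mem' := fun {x y} hx hy => ?_
            zero_mem' := ?_
            smul_mem' := fun c x hx => ?_ }, fun x y hy => ?_, fun x hx => ?_, a, ?_, ?_⟩
  · simp only [Set.mem_ofPred_eq] at hx hy ⊢
    rw [map_add, LinearMap.add_apply, hx, hy, add_zero]
  · change σ₁ 0 η₁ = 0
    rw [map_zero, LinearMap.zero_apply]
  · change σ₁ x η₁ = 0 at hx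
    change σ₁ (c • x) η₁ = 0
    rw [map_smul, LinearMap.smul_apply, hx, smul_zero]
  · change σ₁ y η₁ = 0 at hy
    change σ₁ (x * y) η₁ = 0
    rw [map_mul, Module.End.mul_apply, hy, map_zero]
  · change σ₁ x η₁ = 0
    simpa using h₁ x 0 (by rw [hx, zero_smul])
  · change σ₁ a η₁ ≠ 0
    rw [ha]
    exact fun h0 => hη₂ (T.map_eq_zero_iff.1 h0)
  · intro x c hx
    have h3 : σ₁ x (T η₂) = c • T η₂ := by
      have h4 := h₂ x c hx
      rw [hT] at h4
      have h5 := congrArg T h4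
      simpa using h5
    change σ₁ (x * a - c • a) η₁ = 0
    rw [map_sub, map_mul, map_smul, LinearMap.sub_apply, Module.End.mul_apply,
      LinearMap.smul_apply, ha, h3, sub_self]

end Irreducible

/-! ### Boundary paths -/

variable {V : Type u} {E : Type v}

/-- A vertex is singular when it emits no edge or infinitely many edges, that is, when no relation
`p_v = ∑ s_e s_e^*` is imposed at it. -/
def DiGraph.IsSingular (G : DiGraph V E) (v : V) : Prop :=
  ¬ ∃ F : Finset E, F.Nonempty ∧ ∀ e, e ∈ F ↔ G.s e = v

/-- The condition on consecutive entries of a boundary path: an entry `(v, some e)` says that the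
path leaves `v` along `e`, an entry `(v, none)` that it has ended at the singular vertex `v`. -/
def DiGraph.IsStep (G : DiGraph V E) (a b : V × Option E) : Prop :=
  (∀ e, a.2 = some e → G.s e = a.1 ∧ G.r e = b.1) ∧ (a.2 = none → G.IsSingular a.1 ∧ b = a)

/-- Boundary paths: infinite paths, and finite paths ending at a singular vertex. A finite path
is encoded as a sequence that is eventually constant with value `(v, none)`. -/
def BoundaryPath (G : DiGraph V E) : Type (max u v) :=
  {b : ℕ → V × Option E // ∀ n, G.IsStep (b n) (b (n + 1))}

namespace BoundaryPath

variable {G : DiGraph V E}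

/-- The source of a boundary path. -/
def src (b : BoundaryPath G) : V := (b.1 0).1

/-- The first edge of a boundary path, if it has one. -/
def head (b : BoundaryPath G) : Option E := (b.1 0).2

/-- The boundary path with its first `n` edges removed. -/
def drop (n : ℕ) (b : BoundaryPath G) : BoundaryPath G :=
  ⟨fun i => b.1 (i + n), fun i => by
    have := b.2 (i + n)
    rwa [show i + n + 1 = i + 1 + n by ring] at this⟩

/-- The boundary path with its first edge removed; a path without edges is left alone. -/
def tail (b : BoundaryPath G) : BoundaryPath G := b.drop 1

/-- The boundary path that starts with the edge `e` and continues with `b`. -/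
def cons (e : E) (b : BoundaryPath G) (h : b.src = G.r e) : BoundaryPath G :=
  ⟨fun n => n.casesOn (G.s e, some e) b.1, fun n => by
    cases n with
    | zero =>
      refine ⟨fun f hf => ?_, fun h0 => absurd h0 (Option.some_ne_none e)⟩
      obtain rfl := Option.some.inj hf
      exact ⟨rfl, h.symm⟩
    | succ n => exact b.2 n⟩

@[simp]
theorem src_cons (e : E) (b : BoundaryPath G) (h) : (cons e b h).src = G.s e := rfl

@[simp]
theorem head_cons (e : E) (b : BoundaryPath G) (h) : (cons e b h).head = some e := rfl

@[simp]
theorem tail_cons (e : E) (b : BoundaryPath G) (h) : (cons e b h).tail = b := rfl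

@[simp]
theorem drop_zero (b : BoundaryPath G) : b.drop 0 = b := rfl

theorem drop_drop (b : BoundaryPath G) (m n : ℕ) : (b.drop m).drop n = b.drop (n + m) :=
  Subtype.ext <| funext fun i => congrArg b.1 (by ring)

theorem tail_drop (b : BoundaryPath G) (n : ℕ) : (b.drop n).tail = b.drop (n + 1) := by
  rw [tail, drop_drop, add_comm]

theorem drop_tail (b : BoundaryPath G) (n : ℕ) : b.tail.drop n = b.drop (n + 1) := by
  rw [tail, drop_drop]

theorem src_drop (b : BoundaryPath G) (n : ℕ) : (b.drop n).src = (b.1 n).1 := by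
  simp [src, drop]

theorem head_drop (b : BoundaryPath G) (n : ℕ) : (b.drop n).head = (b.1 n).2 := by
  simp [head, drop]

theorem ext_tail {b c : BoundaryPath G} (hs : b.src = c.src) (hh : b.head = c.head)
    (ht : b.tail = c.tail) : b = c := by
  refine Subtype.ext (funext fun n => ?_)
  cases n with
  | zero => exact Prod.ext hs hh
  | succ n => exact congrFun (congrArg Subtype.val ht) n

theorem s_of_head {b : BoundaryPath G} {e : E} (h : b.head = some e) : G.s e = b.src :=
  ((b.2 0).1 e h).1

theorem src_tail {b : BoundaryPath G} {e : E} (h : b.head = some e) : b.tail.src = G.r e :=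
  ((b.2 0).1 e h).2.symm

theorem cons_tail {b : BoundaryPath G} {e : E} (h : b.head = some e) :
    cons e b.tail (src_tail h) = b :=
  ext_tail (s_of_head h) h.symm rfl

theorem isSingular_src {b : BoundaryPath G} (h : b.head = none) : G.IsSingular b.src :=
  ((b.2 0).2 h).1

theorem drop_of_head_eq_none {b : BoundaryPath G} (h : b.head = none) (n : ℕ) : b.drop n = b := by
  have key : ∀ n, b.1 n = b.1 0 := by
    intro n
    induction n with
    | zero => rfl
    | succ n ih => rw [((b.2 n).2 (by rw [ih]; exact h)).2, ih]
  refine Subtype.ext (funext fun i => ?_)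
  exact (key (i + n)).trans (key i).symm

/-- The path without edges at a singular vertex. -/
def const {v : V} (hv : G.IsSingular v) : BoundaryPath G :=
  ⟨fun _ => (v, none), fun _ => ⟨fun _ h => absurd h (Option.some_ne_none _).symm,
    fun _ => ⟨hv, rfl⟩⟩⟩

/-- The infinite path with the given edges. -/
def ofEdges (f : ℕ → E) (hf : ∀ n, G.r (f n) = G.s (f (n + 1))) : BoundaryPath G :=
  ⟨fun n => (G.s (f n), some (f n)), fun n => ⟨fun e he => by
    obtain rfl := Option.some.inj he
    exact ⟨rfl, hf n⟩, fun h => absurd h (Option.some_ne_none _)⟩⟩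

/-- Every vertex is the source of a boundary path. -/
theorem exists_src_eq (v : V) : ∃ b : BoundaryPath G, b.src = v := by
  classical
  let o : V → Option E := fun v => if h : ∃ e, G.s e = v then some h.choose else none
  let next : V × Option E → V × Option E := fun a =>
    match a.2 with
    | some e => (G.r e, o (G.r e))
    | none => a
  have ho : ∀ v e, o v = some e → G.s e = v := by
    intro v e h
    by_cases hv : ∃ e, G.s e = v
    · simp only [o, dif_pos hv, Option.some.injEq] at h
      rw [← h]
      exact hv.choose_spec
    · simp [o, dif_neg hv] at h
  have ho' : ∀ v, o v = none → G.IsSingular v := by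
    rintro v h ⟨F, ⟨e, he⟩, hF⟩
    have hv : ∃ e, G.s e = v := ⟨e, (hF e).1 he⟩
    simp [o, dif_pos hv] at h
  let b : ℕ → V × Option E := fun n => next^[n] (v, o v)
  have hb : ∀ n, (b n).2 = o (b n).1 := by
    intro n
    induction n with
    | zero => rfl
    | succ n ih =>
      have : b (n + 1) = next (b n) := Function.iterate_succ_apply' next n _
      rw [this]
      simp only [next]
      rcases h : (b n).2 with _ | e
      · simpa [h] using ih
      · rfl
  refine ⟨⟨b, fun n => ⟨fun e he => ?_, fun h => ?_⟩⟩, rfl⟩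
  · refine ⟨ho _ _ ((hb n).symm.trans he), ?_⟩
    have : b (n + 1) = next (b n) := Function.iterate_succ_apply' next n _
    rw [this]
    simp only [next, he]
  · refine ⟨ho' _ ((hb n).symm.trans h), ?_⟩
    have : b (n + 1) = next (b n) := Function.iterate_succ_apply' next n _
    rw [this]
    simp only [next, h]

/-- Two boundary paths are tail equivalent when they agree after the removal of finite initial
segments, possibly of different lengths. -/
def TailEquiv (b c : BoundaryPath G) : Prop := ∃ m n, b.drop m = c.drop n

theorem TailEquiv.cons {b c : BoundaryPath G} (h : TailEquiv b c) {e : E} (hc) :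
    TailEquiv b (cons e c hc) := by
  obtain ⟨m, n, hmn⟩ := h
  exact ⟨m, n + 1, by rw [hmn, ← drop_tail, tail_cons]⟩

theorem TailEquiv.tail {b c : BoundaryPath G} (h : TailEquiv b c) : TailEquiv b c.tail := by
  obtain ⟨m, n, hmn⟩ := h
  exact ⟨m + 1, n, by rw [← tail_drop, hmn, tail_drop, drop_tail]⟩

end BoundaryPath

/-! ### Representations on boundary paths -/

namespace BoundaryPath

variable {G : DiGraph V E} {k : Type w} [Field k] {K : Type w} [Field K] [Algebra k K]

open scoped Classical in
/-- The operator of `p_v`: the projection onto the span of the boundary paths with source `v`. -/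
noncomputable def vertexOp (k : Type w) [Field k] (G : DiGraph V E) (K : Type w) [Field K]
    [Algebra k K] (v : V) : Module.End k (BoundaryPath G →₀ K) :=
  Finsupp.lsum k fun b => if b.src = v then Finsupp.lsingle b else 0

open scoped Classical in
/-- The operator of `s_e`: put `e` in front of boundary paths, and multiply by `A`. -/
noncomputable def edgeOp (k : Type w) [Field k] (G : DiGraph V E) {K : Type w} [Field K]
    [Algebra k K] (A : Kˣ) (e : E) : Module.End k (BoundaryPath G →₀ K) :=
  Finsupp.lsum k fun b => if h : b.src = G.r e then
    Finsupp.lsingle (cons e b h) ∘ₗ LinearMap.mulLeft k (A : K) else 0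

open scoped Classical in
/-- The operator of `s_e^*`: remove the first edge `e` of boundary paths, and divide by `A`. -/
noncomputable def edgeStarOp (k : Type w) [Field k] (G : DiGraph V E) {K : Type w} [Field K]
    [Algebra k K] (A : Kˣ) (e : E) : Module.End k (BoundaryPath G →₀ K) :=
  Finsupp.lsum k fun b => if b.head = some e then
    Finsupp.lsingle b.tail ∘ₗ LinearMap.mulLeft k ((A⁻¹ : Kˣ) : K) else 0

theorem vertexOp_single_of_eq {v : V} {b : BoundaryPath G} (h : b.src = v) (κ : K) :
    vertexOp k G K v (Finsupp.single b κ) = Finsupp.single b κ := by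
  simp [vertexOp, h]

theorem vertexOp_single_of_ne {v : V} {b : BoundaryPath G} (h : b.src ≠ v) (κ : K) :
    vertexOp k G K v (Finsupp.single b κ) = 0 := by
  simp [vertexOp, h]

theorem edgeOp_single_of_eq {A : Kˣ} {e : E} {b : BoundaryPath G} (h : b.src = G.r e) (κ : K) :
    edgeOp k G A e (Finsupp.single b κ) = Finsupp.single (cons e b h) (A * κ) := by
  simp [edgeOp, h]

theorem edgeOp_single_of_ne {A : Kˣ} {e : E} {b : BoundaryPath G} (h : b.src ≠ G.r e) (κ : K) :
    edgeOp k G A e (Finsupp.single b κ) = 0 := by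
  simp [edgeOp, h]

theorem edgeStarOp_single_of_eq {A : Kˣ} {e : E} {b : BoundaryPath G} (h : b.head = some e)
    (κ : K) : edgeStarOp k G A e (Finsupp.single b κ) =
      Finsupp.single b.tail (((A⁻¹ : Kˣ) : K) * κ) := by
  simp [edgeStarOp, h]

theorem edgeStarOp_single_of_ne {A : Kˣ} {e : E} {b : BoundaryPath G} (h : b.head ≠ some e)
    (κ : K) : edgeStarOp k G A e (Finsupp.single b κ) = 0 := by
  simp [edgeStarOp, h]

theorem edgeOp_edgeStarOp_of_eq {A : Kˣ} {e : E} {b : BoundaryPath G} (h : b.head = some e)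
    (κ : K) : edgeOp k G A e (edgeStarOp k G A e (Finsupp.single b κ)) = Finsupp.single b κ := by
  rw [edgeStarOp_single_of_eq h, edgeOp_single_of_eq (src_tail h), cons_tail h,
    Units.mul_inv_cancel_left]

theorem edgeOp_edgeStarOp_of_ne {A : Kˣ} {e : E} {b : BoundaryPath G} (h : b.head ≠ some e)
    (κ : K) : edgeOp k G A e (edgeStarOp k G A e (Finsupp.single b κ)) = 0 := by
  rw [edgeStarOp_single_of_ne h, map_zero]

theorem exists_pathRep (k : Type w) [Field k] (G : DiGraph V E) {K : Type w} [Field K]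
    [Algebra k K] (A : Kˣ) :
    ∃ ρ : LeavittPathAlgebra k G →ₙₐ[k] Module.End k (BoundaryPath G →₀ K),
      (∀ v, ρ (.p v) = vertexOp k G K v) ∧ (∀ e, ρ (.s e) = edgeOp k G A e) ∧
        ∀ e, ρ (.sStar e) = edgeStarOp k G A e := by
  apply LeavittPathAlgebra.exists_lift
  all_goals intros
  all_goals refine Finsupp.lhom_ext fun b κ => ?_
  all_goals try simp only [Module.End.mul_apply, LinearMap.zero_apply]
  · rename_i v
    by_cases h : b.src = v
    · simp only [vertexOp_single_of_eq h]
    · simp only [vertexOp_single_of_ne h, map_zero]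
  · rename_i v v' hv
    by_cases h : b.src = v'
    · rw [vertexOp_single_of_eq h, vertexOp_single_of_ne (by rw [h]; exact hv.symm)]
    · rw [vertexOp_single_of_ne h, map_zero]
  · rename_i e
    by_cases h : b.src = G.r e
    · rw [edgeOp_single_of_eq h, vertexOp_single_of_eq (src_cons e b h)]
    · rw [edgeOp_single_of_ne h, map_zero]
  · rename_i e
    by_cases h : b.src = G.r e
    · rw [vertexOp_single_of_eq h]
    · rw [vertexOp_single_of_ne h, edgeOp_single_of_ne h, map_zero]
  · rename_i e
    by_cases h : b.head = some e
    · rw [edgeStarOp_single_of_eq h, vertexOp_single_of_eq (src_tail h)]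
    · rw [edgeStarOp_single_of_ne h, map_zero]
  · rename_i e
    by_cases h : b.src = G.s e
    · rw [vertexOp_single_of_eq h]
    · rw [vertexOp_single_of_ne h, edgeStarOp_single_of_ne (fun h' => h (s_of_head h').symm),
        map_zero]
  · rename_i e
    by_cases h : b.src = G.r e
    · rw [vertexOp_single_of_eq h, edgeOp_single_of_eq h,
        edgeStarOp_single_of_eq (head_cons e b h), tail_cons, Units.inv_mul_cancel_left]
    · rw [vertexOp_single_of_ne h, edgeOp_single_of_ne h, map_zero]
  · rename_i e f hef
    by_cases h : b.src = G.r f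
    · rw [edgeOp_single_of_eq h, edgeStarOp_single_of_ne]
      rw [head_cons]
      exact fun h' => hef (Option.some.inj h').symm
    · rw [edgeOp_single_of_ne h, map_zero]
  · rename_i v F hF hv
    rw [LinearMap.sum_apply]
    simp only [Module.End.mul_apply]
    by_cases h : b.src = v
    · rw [vertexOp_single_of_eq h]
      rcases hb : b.head with _ | e
      · exact absurd ⟨F, hF, fun e => by rw [hv, h]⟩ (isSingular_src hb)
      · rw [Finset.sum_eq_single e, edgeOp_edgeStarOp_of_eq hb]
        · intro f _ hf
          exact edgeOp_edgeStarOp_of_ne (fun h' => hf (Option.some.inj (h'.symm.trans hb))) κ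
        · exact fun he => absurd ((hv e).2 ((s_of_head hb).trans h)) he
    · rw [vertexOp_single_of_ne h, Finset.sum_eq_zero]
      intro f hf
      exact edgeOp_edgeStarOp_of_ne
        (fun h' => h ((s_of_head h').symm.trans ((hv f).1 hf))) κ

/-- The representation of `L_k(G)` on the space with basis the boundary paths and coefficients in
an extension field `K` of `k`, twisted by a unit `A` of `K` through the gauge action: every edge
acts by concatenation and multiplication by `A`. -/
noncomputable def pathRep (k : Type w) [Field k] (G : DiGraph V E) {K : Type w} [Field K]
    [Algebra k K] (A : Kˣ) :
    LeavittPathAlgebra k G →ₙₐ[k] Module.End k (BoundaryPath G →₀ K) :=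
  (exists_pathRep k G A).choose

theorem pathRep_p (A : Kˣ) (v : V) : pathRep k G A (.p v) = vertexOp k G K v :=
  (exists_pathRep k G A).choose_spec.1 v

theorem pathRep_s (A : Kˣ) (e : E) : pathRep k G A (.s e) = edgeOp k G A e :=
  (exists_pathRep k G A).choose_spec.2.1 e

theorem pathRep_sStar (A : Kˣ) (e : E) : pathRep k G A (.sStar e) = edgeStarOp k G A e :=
  (exists_pathRep k G A).choose_spec.2.2 e

end BoundaryPath

/-! ### Consequences of the uniqueness of irreducible representations -/

namespace BoundaryPath

variable {G : DiGraph V E} {k : Type w} [Field k]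

/-- The element `x` acts in all representations `pathRep` as the projection onto the span of the
boundary paths in `χ`. -/
def ActsAsProjection (x : LeavittPathAlgebra k G) (χ : Set (BoundaryPath G)) : Prop :=
  ∀ (K : Type w) [Field K] [Algebra k K] (A : Kˣ) (b : BoundaryPath G) (κ : K),
    (b ∈ χ → pathRep k G A x (Finsupp.single b κ) = Finsupp.single b κ) ∧
      (b ∉ χ → pathRep k G A x (Finsupp.single b κ) = 0)

theorem actsAsProjection_p (v : V) :
    ActsAsProjection (.p v : LeavittPathAlgebra k G) {b | b.src = v} := by
  intro K _ _ A b κ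
  rw [pathRep_p]
  exact ⟨fun h => vertexOp_single_of_eq h κ, fun h => vertexOp_single_of_ne h κ⟩

theorem ActsAsProjection.mul {x y : LeavittPathAlgebra k G} {χ ψ : Set (BoundaryPath G)}
    (hx : ActsAsProjection x χ) (hy : ActsAsProjection y ψ) : ActsAsProjection (x * y) (χ ∩ ψ) := by
  intro K _ _ A b κ
  rw [map_mul, Module.End.mul_apply]
  refine ⟨fun h => by rw [(hy K A b κ).1 h.2, (hx K A b κ).1 h.1], fun h => ?_⟩
  by_cases hb : b ∈ ψ
  · rw [(hy K A b κ).1 hb, (hx K A b κ).2 fun h' => h ⟨h', hb⟩]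
  · rw [(hy K A b κ).2 hb, map_zero]

theorem ActsAsProjection.sub {x y : LeavittPathAlgebra k G} {χ ψ : Set (BoundaryPath G)}
    (hx : ActsAsProjection x χ) (hy : ActsAsProjection y ψ) (hψ : ψ ⊆ χ) :
    ActsAsProjection (x - y) (χ \ ψ) := by
  intro K _ _ A b κ
  rw [map_sub, LinearMap.sub_apply]
  refine ⟨fun h => by rw [(hx K A b κ).1 h.1, (hy K A b κ).2 h.2, sub_zero], fun h => ?_⟩
  by_cases hb : b ∈ χ
  · rw [(hx K A b κ).1 hb, (hy K A b κ).1 (by_contra fun h' => h ⟨hb, h'⟩), sub_self]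
  · rw [(hx K A b κ).2 hb, (hy K A b κ).2 fun h' => hb (hψ h'), sub_zero]

theorem ActsAsProjection.conj {x : LeavittPathAlgebra k G} {χ : Set (BoundaryPath G)}
    (hx : ActsAsProjection x χ) (e : E) :
    ActsAsProjection (.s e * x * .sStar e) {b | b.head = some e ∧ b.tail ∈ χ} := by
  intro K _ _ A b κ
  rw [map_mul, map_mul, Module.End.mul_apply, Module.End.mul_apply, pathRep_s, pathRep_sStar]
  by_cases he : b.head = some e
  · refine ⟨fun h => ?_, fun h => ?_⟩
    · rw [edgeStarOp_single_of_eq he, (hx K A _ _).1 h.2, ← edgeStarOp_single_of_eq (k := k) he,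
        edgeOp_edgeStarOp_of_eq he]
    · rw [edgeStarOp_single_of_eq he, (hx K A _ _).2 fun h' => h ⟨he, h'⟩, map_zero]
  · refine ⟨fun h => absurd h.1 he, fun _ => ?_⟩
    rw [edgeStarOp_single_of_ne he, map_zero, map_zero]

/-- Distinct boundary paths are separated by an element that acts as a projection. -/
theorem exists_actsAsProjection_of_ne (k : Type w) [Field k] {b c : BoundaryPath G} (h : b ≠ c) :
    ∃ (x : LeavittPathAlgebra k G) (χ : Set (BoundaryPath G)),
      ActsAsProjection x χ ∧ b ∈ χ ∧ c ∉ χ := by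
  have key : ∀ b c : BoundaryPath G, b.1 0 ≠ c.1 0 →
      ∃ (x : LeavittPathAlgebra k G) (χ : Set (BoundaryPath G)),
        ActsAsProjection x χ ∧ b ∈ χ ∧ c ∉ χ := by
    intro b c h
    by_cases hs : c.src = b.src
    · have hh : b.head ≠ c.head := fun h' => h (Prod.ext hs.symm h')
      rcases hb : b.head with _ | e
      · rcases hc : c.head with _ | e
        · exact absurd (hb.trans hc.symm) hh
        · refine ⟨_, _, (actsAsProjection_p b.src).sub ((actsAsProjection_p (G.r e)).conj e)
            (fun d hd => (s_of_head hd.1).symm.trans ((s_of_head hc).trans hs)), ⟨rfl, ?_⟩, ?_⟩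
          · rintro ⟨h', -⟩
            exact Option.some_ne_none e (h'.symm.trans hb)
          · exact fun h' => h'.2 ⟨hc, src_tail hc⟩
      · refine ⟨_, _, (actsAsProjection_p (G.r e)).conj e, ⟨hb, src_tail hb⟩, ?_⟩
        exact fun h' => hh (hb.trans h'.1.symm)
    · exact ⟨_, _, actsAsProjection_p b.src, rfl, hs⟩
  obtain ⟨n, hn⟩ : ∃ n, b.1 n ≠ c.1 n := by
    by_contra hc
    push Not at hc
    exact h (Subtype.ext (funext hc))
  clear h
  induction n generalizing b c with
  | zero => exact key b c hn
  | succ n ih =>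
    by_cases h0 : b.1 0 = c.1 0
    · obtain ⟨x, χ, hx, hb, hc⟩ := ih (b := b.tail) (c := c.tail) hn
      have hh : b.head = c.head := congrArg Prod.snd h0
      rcases hbh : b.head with _ | e
      · rw [tail, drop_of_head_eq_none hbh] at hb
        rw [tail, drop_of_head_eq_none (hh.symm.trans hbh)] at hc
        exact ⟨x, χ, hx, hb, hc⟩
      · exact ⟨_, _, hx.conj e, ⟨hbh, hb⟩, fun h => hc h.2⟩
    · exact key b c h0

theorem exists_actsAsProjection_of_notMem (k : Type w) [Field k] {b : BoundaryPath G}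
    (F : Finset (BoundaryPath G)) (hb : b ∉ F) :
    ∃ (x : LeavittPathAlgebra k G) (χ : Set (BoundaryPath G)),
      ActsAsProjection x χ ∧ b ∈ χ ∧ ∀ c ∈ F, c ∉ χ := by
  classical
  induction F using Finset.induction_on with
  | empty => exact ⟨_, _, actsAsProjection_p b.src, rfl, by simp⟩
  | insert c F _ ih =>
    rw [Finset.mem_insert, not_or] at hb
    obtain ⟨x, χ, hx, hbx, hF⟩ := ih hb.2
    obtain ⟨y, ψ, hy, hby, hc⟩ := exists_actsAsProjection_of_ne k hb.1
    refine ⟨_, _, hx.mul hy, ⟨hbx, hby⟩, fun d hd h => ?_⟩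
    rcases Finset.mem_insert.1 hd with rfl | hd
    · exact hc h.2
    · exact hF d hd h.1

/-- The span of a tail equivalence class is invariant. -/
theorem pathRep_mem_supported (b : BoundaryPath G) (a : LeavittPathAlgebra k G)
    {f : BoundaryPath G →₀ k} (hf : f ∈ Finsupp.supported k k {c | TailEquiv b c}) :
    pathRep k G (1 : kˣ) a f ∈ Finsupp.supported k k {c | TailEquiv b c} := by
  have gen : ∀ T : Module.End k (BoundaryPath G →₀ k),
      (∀ c, TailEquiv b c → T (Finsupp.single c 1) ∈ Finsupp.supported k k {c | TailEquiv b c}) →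
      ∀ f ∈ Finsupp.supported k k {c | TailEquiv b c},
        T f ∈ Finsupp.supported k k {c | TailEquiv b c} := by
    intro T hT f hf
    have hle : Finsupp.supported k k {c | TailEquiv b c} ≤
        (Finsupp.supported k k {c | TailEquiv b c}).comap T := by
      conv_lhs => rw [Finsupp.supported_eq_span_single]
      rw [Submodule.span_le]
      rintro _ ⟨c, hc, rfl⟩
      exact hT c hc
    exact hle hf
  induction a using LeavittPathAlgebra.induction generalizing f with
  | hp v =>
    rw [pathRep_p]
    refine gen _ (fun c hc => ?_) f hf
    by_cases h : c.src = v
    · rw [vertexOp_single_of_eq h]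
      exact Finsupp.single_mem_supported k _ hc
    · rw [vertexOp_single_of_ne h]
      exact Submodule.zero_mem _
  | hs e =>
    rw [pathRep_s]
    refine gen _ (fun c hc => ?_) f hf
    by_cases h : c.src = G.r e
    · rw [edgeOp_single_of_eq h]
      exact Finsupp.single_mem_supported k _ (hc.cons h)
    · rw [edgeOp_single_of_ne h]
      exact Submodule.zero_mem _
  | hsStar e =>
    rw [pathRep_sStar]
    refine gen _ (fun c hc => ?_) f hf
    by_cases h : c.head = some e
    · rw [edgeStarOp_single_of_eq h]
      exact Finsupp.single_mem_supported k _ hc.tail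
    · rw [edgeStarOp_single_of_ne h]
      exact Submodule.zero_mem _
  | hzero =>
    rw [map_zero]
    exact Submodule.zero_mem _
  | hadd a a' iha ihb =>
    rw [map_add]
    exact Submodule.add_mem _ (iha hf) (ihb hf)
  | hmul a a' iha ihb =>
    rw [map_mul]
    exact iha (ihb hf)
  | hsmul c a ih =>
    rw [map_smul]
    exact Submodule.smul_mem _ c (ih hf)

/-- The element that moves along the first `n` edges of a boundary path. -/
theorem exists_pathRep_drop (k : Type w) [Field k] (n : ℕ) (b : BoundaryPath G)
    (hb : ∀ i < n, (b.1 i).2 ≠ none) :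
    ∃ C : LeavittPathAlgebra k G, ∀ (K : Type w) [Field K] [Algebra k K] (A : Kˣ) (κ : K),
      pathRep k G A C (Finsupp.single (b.drop n) κ) = Finsupp.single b ((A : K) ^ n * κ) := by
  induction n generalizing b with
  | zero =>
    refine ⟨.p b.src, fun K _ _ A κ => ?_⟩
    rw [pow_zero, one_mul, drop_zero, pathRep_p, vertexOp_single_of_eq rfl]
  | succ n ih =>
    obtain ⟨C, hC⟩ := ih b.tail fun i hi => hb (i + 1) (by omega)
    rcases hh : b.head with _ | e
    · exact absurd hh (hb 0 (by omega))
    · refine ⟨.s e * C, fun K _ _ A κ => ?_⟩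
      rw [map_mul, Module.End.mul_apply, ← drop_tail, hC, pathRep_s,
        edgeOp_single_of_eq (src_tail hh), cons_tail hh, pow_succ', mul_assoc]

/-- If `L_k(G)` has a unique irreducible representation, then some `L_k(G) / m` contains vectors
`ξ` (the generator) and `a ξ` that satisfy the relations of the basis vector `b` of the untwisted,
and of the basis vector `b'` of a twisted representation on boundary paths. Separating `b'` from the finitely many other paths in the
support shows that `a` may be taken to move `b` to a nonzero multiple of `b'`. -/
theorem exists_leftIdeal_pathRep (h : HasUniqueIrreducibleRep k (LeavittPathAlgebra k G))
    {K : Type w} [Field K] [Algebra k K] (A : Kˣ) (b b' : BoundaryPath G) :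
    ∃ m : Submodule k (LeavittPathAlgebra k G), (∀ x y, y ∈ m → x * y ∈ m) ∧
      (∀ x, pathRep k G (1 : kˣ) x (Finsupp.single b 1) = 0 → x ∈ m) ∧
      ∃ a, a ∉ m ∧
        (∀ x (c : k), pathRep k G A x (Finsupp.single b' (1 : K)) = c • Finsupp.single b' 1 →
          x * a - c • a ∈ m) ∧
        ∃ κ : k, κ ≠ 0 ∧
          pathRep k G (1 : kˣ) a (Finsupp.single b 1) = Finsupp.single b' κ := by
  classical
  obtain ⟨m, hm, hm₁, a, ha, hm₂⟩ := exists_leftIdeal_of_equivalent h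
    (pathRep k G (1 : kˣ)) (ξ₁ := Finsupp.single b 1) (by simp) (u₁ := .p b.src)
    (by rw [pathRep_p, vertexOp_single_of_eq rfl])
    (pathRep k G A) (ξ₂ := Finsupp.single b' (1 : K)) (by simp) (u₂ := .p b'.src)
    (by rw [pathRep_p, vertexOp_single_of_eq rfl])
  set f := pathRep k G (1 : kˣ) a (Finsupp.single b 1) with hf
  obtain ⟨x, χ, hx, hb', hχ⟩ := exists_actsAsProjection_of_notMem k (f.support.erase b')
    (Finset.notMem_erase b' _)
  have hxa : pathRep k G (1 : kˣ) (x * a) (Finsupp.single b 1) = Finsupp.single b' (f b') := by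
    rw [map_mul, Module.End.mul_apply, ← hf]
    conv_lhs => rw [← Finsupp.single_add_erase b' f, map_add, (hx k 1 b' _).1 hb']
    rw [← Finsupp.sum_single (f.erase b'), map_finsuppSum, Finsupp.sum, Finset.sum_eq_zero,
      add_zero]
    intro c hc
    rw [Finsupp.support_erase] at hc
    exact (hx k 1 c _).2 (hχ c hc)
  have hsub : x * a - a ∈ m := by
    simpa using hm₂ x 1 (by rw [one_smul]; exact (hx K A b' 1).1 hb')
  have hxm : x * a ∉ m := fun h' => ha <| by
    have := m.sub_mem h' hsub
    rwa [sub_sub_cancel] at this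
  refine ⟨m, hm, hm₁, x * a, hxm, fun y c hy => ?_, f b', fun h0 => hxm (hm₁ _ ?_), hxa⟩
  · have : y * (x * a) - c • (x * a) = y * (x * a - a) + (y * a - c • a) - c • (x * a - a) := by
      rw [mul_sub, smul_sub]
      abel
    rw [this]
    exact m.sub_mem (m.add_mem (hm _ _ hsub) (hm₂ y c hy)) (m.smul_mem c hsub)
  · rw [hxa, h0, Finsupp.single_zero]

theorem tailEquiv_of_unique (h : HasUniqueIrreducibleRep k (LeavittPathAlgebra k G))
    (b b' : BoundaryPath G) : TailEquiv b b' := by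
  obtain ⟨m, -, -, a, -, -, κ, hκ, ha⟩ := exists_leftIdeal_pathRep h (1 : kˣ) b b'
  have := pathRep_mem_supported b a
    (Finsupp.single_mem_supported k (1 : k) (show b ∈ {c | TailEquiv b c} from ⟨0, 0, rfl⟩))
  rw [ha, Finsupp.mem_supported] at this
  exact this (by simp [hκ])

/-- There is no periodic infinite path: for a unit `A` such that `r = A ^ n` is a root of
`X ^ 2 - X + 1`, the vector `a ξ` that corresponds to the path in the representation twisted by
`A` is annihilated by `C ^ 2 - C + 1`, `C` being the element that moves once around the period;
but `C` fixes multiples of the path in the untwisted representation. -/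
theorem drop_ne_self_of_unique (h : HasUniqueIrreducibleRep k (LeavittPathAlgebra k G))
    {b : BoundaryPath G} {n : ℕ} (hn : 0 < n) (hb : ∀ i, (b.1 i).2 ≠ none) :
    b.drop n ≠ b := by
  intro hbn
  obtain ⟨r, hr⟩ : ∃ r : AlgebraicClosure k, r * r - r + 1 = 0 := by
    obtain ⟨r, hr⟩ := IsAlgClosed.exists_root
      (Polynomial.X ^ 2 - Polynomial.X + 1 : Polynomial (AlgebraicClosure k)) (by
        have : (Polynomial.X ^ 2 - Polynomial.X + 1 :
            Polynomial (AlgebraicClosure k)).degree = 2 := by compute_degree!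
        rw [this]
        exact two_ne_zero)
    refine ⟨r, ?_⟩
    simpa [Polynomial.IsRoot, sq] using hr
  obtain ⟨t, ht⟩ := IsAlgClosed.exists_pow_nat_eq r hn
  have hr0 : r ≠ 0 := by
    rintro rfl
    simp at hr
  have ht0 : t ≠ 0 := by
    rintro rfl
    exact hr0 (by rw [← ht, zero_pow hn.ne'])
  obtain ⟨m, hm, hm₁, a, ha, hm₂, κ, -, hκ⟩ := exists_leftIdeal_pathRep h (Units.mk0 t ht0) b b
  obtain ⟨C, hC⟩ := exists_pathRep_drop k n b fun i _ => hb i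
  simp only [hbn] at hC
  have h₁ : C * a - a ∈ m := by
    refine hm₁ _ ?_
    rw [map_sub, map_mul, LinearMap.sub_apply, Module.End.mul_apply, hκ, hC]
    simp
  have h₂ : (C * C - C + .p b.src) * a - (0 : k) • a ∈ m := by
    refine hm₂ _ 0 ?_
    rw [map_add, map_sub, map_mul, LinearMap.add_apply, LinearMap.sub_apply,
      Module.End.mul_apply, hC, hC, pathRep_p, vertexOp_single_of_eq rfl, ← Finsupp.single_sub,
      ← Finsupp.single_add, Units.val_mk0, ht, mul_one, hr, Finsupp.single_zero, zero_smul]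
  have h₃ : .p b.src * a - (1 : k) • a ∈ m := by
    refine hm₂ _ 1 ?_
    rw [pathRep_p, vertexOp_single_of_eq rfl, one_smul]
  refine ha ?_
  have : a = (C * C - C + .p b.src) * a - (0 : k) • a - C * (C * a - a)
      - (.p b.src * a - (1 : k) • a) := by
    rw [zero_smul, one_smul, add_mul, sub_mul, mul_sub, mul_assoc]
    abel
  rw [this]
  exact m.sub_mem (m.sub_mem h₂ (hm _ _ h₁)) h₃

end BoundaryPath

/-! ### The graph when all boundary paths are tail equivalent -/

namespace BoundaryPath

variable {G : DiGraph V E}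

/-- Without periodic infinite paths there are no closed paths. -/
theorem src_drop_ne_of_forall_drop_ne
    (hP : ∀ (b : BoundaryPath G) (n : ℕ), 0 < n → (∀ i, (b.1 i).2 ≠ none) → b.drop n ≠ b)
    (b : BoundaryPath G) {m : ℕ} (hm : 0 < m) (hb : ∀ i < m, (b.1 i).2 ≠ none) :
    (b.drop m).src ≠ b.src := by
  intro hbm
  rw [src_drop] at hbm
  let q : BoundaryPath G := ⟨fun i => b.1 (i % m), fun i => by
    have hi := Nat.mod_lt i hm
    change G.IsStep (b.1 (i % m)) (b.1 ((i + 1) % m))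
    rcases Nat.lt_or_ge (i % m + 1) m with h | h
    · have : (i + 1) % m = i % m + 1 := by
        rw [Nat.add_mod, Nat.mod_eq_of_lt (show 1 < m by omega), Nat.mod_eq_of_lt h]
      rw [this]
      exact b.2 (i % m)
    · have hi' : i % m + 1 = m := by omega
      have : (i + 1) % m = 0 := by
        have := Nat.div_add_mod i m
        rw [show i + 1 = m * (i / m + 1) by rw [mul_add, mul_one]; omega]
        exact Nat.mul_mod_right _ _
      rw [this]
      refine ⟨fun e he => ?_, fun h0 => absurd h0 (hb _ hi)⟩
      have := (b.2 (i % m)).1 e he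
      rw [hi', hbm] at this
      exact this⟩
  refine hP q m hm (fun i => hb _ (Nat.mod_lt i hm)) (Subtype.ext (funext fun i => ?_))
  exact congrArg b.1 (Nat.add_mod_right i m)

/-- An infinite emitter `v` would lie on a closed path: any boundary path that starts with an edge
leaving `v` is tail equivalent to the path without edges at `v`. -/
theorem s_ne_of_isSingular (hT : ∀ b c : BoundaryPath G, TailEquiv b c)
    (hC : ∀ (b : BoundaryPath G) {m : ℕ}, 0 < m → (∀ i < m, (b.1 i).2 ≠ none) →
      (b.drop m).src ≠ b.src)
    {v : V} (hv : G.IsSingular v) (e : E) : G.s e ≠ v := by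
  classical
  rintro rfl
  obtain ⟨c, hc⟩ := exists_src_eq (G := G) (G.r e)
  let b := cons e c hc
  obtain ⟨m, n, hmn⟩ := hT b (const hv)
  rw [drop_of_head_eq_none (b := const hv) rfl] at hmn
  have hex : ∃ m, (b.1 m).2 = none := ⟨m, by rw [← head_drop, hmn]; rfl⟩
  have hl := Nat.find_spec hex
  have hlt : Nat.find hex ≤ m := Nat.find_min' hex (by rw [← head_drop, hmn]; rfl)
  refine hC b (m := Nat.find hex) ?_ (fun i hi => Nat.find_min hex hi) ?_
  · refine Nat.pos_of_ne_zero fun h0 => ?_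
    rw [h0] at hl
    exact Option.some_ne_none e hl
  · have h1 : b.drop (Nat.find hex) = const hv := by
      rw [← hmn, ← Nat.sub_add_cancel hlt, ← drop_drop]
      exact (drop_of_head_eq_none (by rw [head_drop]; exact hl) _).symm
    rw [h1]
    rfl

/-- The Baire property of the space of boundary paths, with the topology of pointwise convergence
of sequences in a discrete set: a countable union of closed sets that is the whole space contains a
cylinder set. -/
theorem exists_cylinder_subset {ι : Type*} [Countable ι] [Nonempty (BoundaryPath G)]
    (F : ι → Set (BoundaryPath G))
    (hF : ∀ i, ∀ b ∉ F i, ∃ N : ℕ, ∀ c : BoundaryPath G, (∀ j < N, c.1 j = b.1 j) → c ∉ F i)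
    (hcov : ∀ b, ∃ i, b ∈ F i) :
    ∃ (i : ι) (b : BoundaryPath G) (N : ℕ),
      ∀ c : BoundaryPath G, (∀ j < N, c.1 j = b.1 j) → c ∈ F i := by
  let _ : TopologicalSpace (V × Option E) := ⊥
  have : DiscreteTopology (V × Option E) := ⟨rfl⟩
  let X : Set (ℕ → V × Option E) := {b | ∀ n, G.IsStep (b n) (b (n + 1))}
  have hX : IsClosed X := by
    have : X = ⋂ n, (fun b : ℕ → V × Option E => (b n, b (n + 1))) ⁻¹'
        {q | G.IsStep q.1 q.2} := by
      ext b
      simp [X]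
    rw [this]
    exact isClosed_iInter fun n => (isClosed_discrete _).preimage (by fun_prop)
  have := hX.isCompletelyMetrizableSpace
  have : Nonempty X := ‹Nonempty (BoundaryPath G)›
  have hopen : ∀ (b : BoundaryPath G) (N : ℕ),
      IsOpen {c : X | ∀ j < N, c.1 j = b.1 j} := by
    intro b N
    have : {c : X | ∀ j < N, c.1 j = b.1 j} = ⋂ j ∈ Finset.range N,
        (fun c : X => c.1 j) ⁻¹' {b.1 j} := by
      ext c
      simp
    rw [this]
    exact isOpen_biInter_finset fun j _ => (isOpen_discrete _).preimage
      ((continuous_apply j).comp continuous_subtype_val)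
  let F' : ι → Set X := F
  obtain ⟨i, b, hb⟩ := nonempty_interior_of_iUnion_of_closed (f := F') (fun i => by
      rw [← isOpen_compl_iff, isOpen_iff_mem_nhds]
      intro b hb
      obtain ⟨N, hN⟩ := hF i b hb
      exact Filter.mem_of_superset ((hopen b N).mem_nhds fun _ _ => rfl) hN)
    (Set.eq_univ_of_forall fun b => Set.mem_iUnion.2 (hcov b))
  rw [mem_interior_iff_mem_nhds, mem_nhds_subtype] at hb
  obtain ⟨U, hU, hUF⟩ := hb
  obtain ⟨W, hWU, hW, hbW⟩ := mem_nhds_iff.1 hU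
  obtain ⟨I, t, hI, hIW⟩ := isOpen_pi_iff.1 hW b.1 hbW
  refine ⟨i, b, I.sup id + 1, fun c hc => hUF (hWU (hIW fun j hj => ?_))⟩
  rw [hc j (Nat.lt_succ_of_le (Finset.le_sup (f := id) hj))]
  exact (hI j hj).2

/-- A boundary path can be continued arbitrarily after finitely many edges. -/
theorem exists_append (M : ℕ) (b c : BoundaryPath G) (hb : ∀ i < M, (b.1 i).2 ≠ none)
    (hc : c.src = (b.drop M).src) :
    ∃ d : BoundaryPath G, (∀ i < M, d.1 i = b.1 i) ∧ d.drop M = c ∧ d.src = b.src := by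
  induction M generalizing b with
  | zero => exact ⟨c, by simp, rfl, hc⟩
  | succ M ih =>
    obtain ⟨d, hd, hdc, hs⟩ := ih b.tail (fun i hi => hb (i + 1) (by omega))
      (by rw [hc, drop_tail])
    rcases hh : b.head with _ | e
    · exact absurd hh (hb 0 (by omega))
    · refine ⟨cons e d (hs.trans (src_tail hh)), fun i hi => ?_, ?_, s_of_head hh⟩
      · cases i with
        | zero => exact Prod.ext (s_of_head hh) hh.symm
        | succ i => exact hd i (by omega)
      · rw [← drop_tail, tail_cons, hdc]

/-- If all boundary paths are tail equivalent and all singular vertices are sinks, then some vertex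
is the source of only one boundary path. By tail equivalence with a fixed `b₀`, the closed sets
`{b | b.drop m = b₀.drop n}` cover the space of boundary paths, so one of them contains a
cylinder. -/
theorem exists_forall_src_eq [Nonempty (BoundaryPath G)]
    (hT : ∀ b c : BoundaryPath G, TailEquiv b c)
    (hS : ∀ v, G.IsSingular v → ∀ e, G.s e ≠ v) :
    ∃ ω : BoundaryPath G, ∀ c : BoundaryPath G, c.src = ω.src → c = ω := by
  let b₀ : BoundaryPath G := Classical.arbitrary _
  obtain ⟨⟨m, n⟩, b, N, hN⟩ := exists_cylinder_subset
    (fun q : ℕ × ℕ => {b : BoundaryPath G | b.drop q.1 = b₀.drop q.2}) (by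
      rintro ⟨m, n⟩ b hb
      obtain ⟨i, hi⟩ : ∃ i, (b.drop m).1 i ≠ (b₀.drop n).1 i := by
        by_contra hc
        push Not at hc
        exact hb (Subtype.ext (funext hc))
      refine ⟨i + m + 1, fun c hc h => hi ?_⟩
      have h1 : (c.drop m).1 i = (b₀.drop n).1 i := congrFun (congrArg Subtype.val h) i
      rw [← h1]
      exact (hc (i + m) (by omega)).symm)
    (fun b => by
      obtain ⟨m, n, h⟩ := hT b b₀
      exact ⟨(m, n), h⟩)
  by_cases hb : ∃ i, (b.1 i).2 = none
  · obtain ⟨i, hi⟩ := hb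
    rw [← head_drop] at hi
    refine ⟨b.drop i, fun c hc => ?_⟩
    have hch : c.head = none := by
      rcases hh : c.head with _ | e
      · rfl
      · exact absurd ((s_of_head hh).trans hc) (hS _ (isSingular_src hi) e)
    refine Subtype.ext (funext fun j => ?_)
    have h1 := drop_of_head_eq_none hch j
    have h2 := drop_of_head_eq_none hi j
    refine Prod.ext ?_ ?_
    · rw [← src_drop, ← src_drop, h1, h2, hc]
    · rw [← head_drop, ← head_drop, h1, h2, hch, hi]
  · push Not at hb
    refine ⟨b.drop (N + m), fun c hc => ?_⟩
    obtain ⟨d, hd, rfl, -⟩ := exists_append (N + m) b c (fun i _ => hb i) hc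
    have h1 : d.drop m = b₀.drop n := hN d fun j hj => hd j (by omega)
    have h2 : b.drop m = b₀.drop n := hN b fun _ _ => rfl
    rw [← drop_drop, ← drop_drop, h1, h2]

theorem eq_drop_of_src_eq {ω : BoundaryPath G} (hω : ∀ c : BoundaryPath G, c.src = ω.src → c = ω)
    (n : ℕ) (c : BoundaryPath G) (hc : c.src = (ω.drop n).src) : c = ω.drop n := by
  induction n generalizing c with
  | zero => exact hω c hc
  | succ n ih =>
    rw [← tail_drop] at hc ⊢
    rcases hh : (ω.drop n).head with _ | e
    · rw [tail, drop_of_head_eq_none hh 1] at hc ⊢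
      exact ih c hc
    · rw [← ih (cons e c (hc.trans (src_tail hh))) (s_of_head hh), tail_cons]

/-- The relation "an edge leads from `v` to `v'`", restricted to vertices `v` outside the boundary
path `ω`, is well founded if all boundary paths are tail equivalent. -/
theorem wellFounded_edge (hT : ∀ b c : BoundaryPath G, TailEquiv b c) (ω : BoundaryPath G) :
    WellFounded fun v' v : V => (∀ n, (ω.drop n).src ≠ v) ∧ ∃ e, G.s e = v ∧ G.r e = v' := by
  rw [wellFounded_iff_isEmpty_descending_chain]
  refine ⟨fun ⟨f, hf⟩ => ?_⟩
  choose hω e hs hr using hf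
  obtain ⟨m, n, h⟩ := hT (ofEdges e fun n => (hr n).trans (hs (n + 1)).symm) ω
  refine hω m n ?_
  rw [← h, src_drop]
  exact hs m

end BoundaryPath

/-! ### The minimal idempotent of a vertex with a unique boundary path -/

namespace BoundaryPath

variable {G : DiGraph V E} {k : Type w} [Field k]

/-- The element `s_{e_n}^* ⋯ s_{e_1}^*`, where `e_1, …, e_n` are the first `n` edges of `b`, or all
edges of `b` if there are fewer. -/
def ghostPath (k : Type w) [Field k] (b : BoundaryPath G) : ℕ → LeavittPathAlgebra k G
  | 0 => .p b.src
  | n + 1 => match (b.drop n).head with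
    | some e => .sStar e * ghostPath k b n
    | none => ghostPath k b n

theorem p_mul_ghostPath (b : BoundaryPath G) (n : ℕ) :
    .p (b.drop n).src * ghostPath k b n = ghostPath k b n := by
  induction n with
  | zero => exact LeavittPathAlgebra.p_mul_self _
  | succ n ih =>
    rcases hh : (b.drop n).head with _ | e
    · simp only [ghostPath, hh]
      rw [← tail_drop, tail, drop_of_head_eq_none hh, ih]
    · simp only [ghostPath, hh]
      rw [← tail_drop, src_tail hh, ← mul_assoc, LeavittPathAlgebra.p_mul_sStar]

theorem head_drop_ne_none {b : BoundaryPath G} {m n : ℕ} (hmn : m ≤ n)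
    (h : (b.drop n).head ≠ none) : (b.drop m).head ≠ none := by
  intro h0
  rw [← Nat.sub_add_cancel hmn, ← drop_drop, drop_of_head_eq_none h0] at h
  exact h h0

/-- If `ω` is the only boundary path with source `w`, then `L_k(G) p_w` contains a copy
`y : X → L_k(G)` of the basis of boundary paths, on which the generators act by concatenation and
removal of edges. Along `ω` the elements `y_b` are ghost paths; elsewhere `y_b = s_e y_{tail b}` by
well-founded recursion. -/
theorem exists_basis_lift (hT : ∀ b c : BoundaryPath G, TailEquiv b c)
    (hC : ∀ (b : BoundaryPath G) {m : ℕ}, 0 < m → (∀ i < m, (b.1 i).2 ≠ none) →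
      (b.drop m).src ≠ b.src)
    {ω : BoundaryPath G} (hω : ∀ c : BoundaryPath G, c.src = ω.src → c = ω) :
    ∃ y : BoundaryPath G → LeavittPathAlgebra k G, y ω = .p ω.src ∧
      (∀ b, .p b.src * y b = y b) ∧
      ∀ b e, b.head = some e → .s e * y b.tail = y b := by
  classical
  have wf := InvImage.wf (src (G := G)) (wellFounded_edge hT ω)
  let y : BoundaryPath G → LeavittPathAlgebra k G := wf.fix fun b IH =>
    if h : ∃ n, (ω.drop n).src = b.src then ghostPath k ω (Nat.find h)
    else if h' : ∃ e, b.head = some e then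
      .s h'.choose * IH b.tail ⟨not_exists.1 h, h'.choose, s_of_head h'.choose_spec,
        (src_tail h'.choose_spec).symm⟩
    else 0
  have y_of : ∀ b (h : ∃ n, (ω.drop n).src = b.src), y b = ghostPath k ω (Nat.find h) := by
    intro b h
    simp only [y]
    rw [wf.fix_eq, dif_pos h]
  have y_of_not : ∀ b e, (¬ ∃ n, (ω.drop n).src = b.src) → b.head = some e →
      y b = .s e * y b.tail := by
    intro b e h he
    have h' : ∃ e, b.head = some e := ⟨e, he⟩
    have hc : h'.choose = e := Option.some.inj (h'.choose_spec.symm.trans he)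
    conv_lhs => simp only [y]
    rw [wf.fix_eq, dif_neg h, dif_pos h']
    exact congrArg (fun f => .s f * y b.tail) hc
  have y_zero : ∀ b, (¬ ∃ n, (ω.drop n).src = b.src) → b.head = none → y b = 0 := by
    intro b h he
    simp only [y]
    rw [wf.fix_eq, dif_neg h, dif_neg (by simp [he])]
  refine ⟨y, ?_, fun b => ?_, fun b e he => ?_⟩
  · have h : ∃ n, (ω.drop n).src = ω.src := ⟨0, rfl⟩
    rw [y_of ω h, (Nat.find_eq_zero h).2 rfl]
    rfl
  · by_cases h : ∃ n, (ω.drop n).src = b.src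
    · have h1 := p_mul_ghostPath (k := k) ω (Nat.find h)
      rw [Nat.find_spec h] at h1
      rw [y_of b h, h1]
    · rcases he : b.head with _ | e
      · rw [y_zero b h he, mul_zero]
      · rw [y_of_not b e h he, ← mul_assoc, ← s_of_head he, LeavittPathAlgebra.p_mul_s]
  · by_cases h : ∃ n, (ω.drop n).src = b.src
    · set n := Nat.find h with hn
      have hb : b = ω.drop n := eq_drop_of_src_eq hω n b (Nat.find_spec h).symm
      have hh : (ω.drop n).head = some e := hb ▸ he
      have hsrc : (ω.drop (n + 1)).src = b.tail.src := by rw [hb, tail_drop]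
      have h' : ∃ n, (ω.drop n).src = b.tail.src := ⟨n + 1, hsrc⟩
      -- The vertices on `ω` up to its end are distinct, as there are no closed paths.
      have hn' : Nat.find h' = n + 1 := by
        refine (Nat.find_eq_iff h').2 ⟨hsrc, fun m hm hmb => ?_⟩
        refine hC (ω.drop m) (m := n + 1 - m) (by omega) (fun i hi => ?_) ?_
        · rw [← head_drop, drop_drop]
          exact head_drop_ne_none (n := n) (by omega) (by rw [hh]; exact Option.some_ne_none e)
        · rw [drop_drop, Nat.sub_add_cancel hm.le, hmb, hsrc]
      -- As `ω` is the only continuation, `e` is the only edge leaving its source.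
      have hp : (.p b.src : LeavittPathAlgebra k G) = .s e * .sStar e := by
        rw [LeavittPathAlgebra.p_eq_sum (F := {e}) (Finset.singleton_nonempty e) fun f => ?_,
          Finset.sum_singleton]
        rw [Finset.mem_singleton]
        refine ⟨fun hf => hf ▸ s_of_head he, fun hf => ?_⟩
        obtain ⟨c, hc⟩ := exists_src_eq (G := G) (G.r f)
        have h1 := eq_drop_of_src_eq hω n (cons f c hc) (by rw [src_cons, hf, ← hb])
        exact Option.some.inj ((congrArg head h1).trans hh)
      have hz : ghostPath k ω (n + 1) = .sStar e * ghostPath k ω n := by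
        simp only [ghostPath, hh]
      rw [y_of b h, y_of b.tail h', hn', hz, ← mul_assoc, ← hp, ← hn]
      conv_lhs => rw [hb]
      exact p_mul_ghostPath ω n
    · exact (y_of_not b e h he).symm

/-- The representation on boundary paths embeds into the left regular representation, with `ω` sent
to `p_w`. -/
theorem exists_intertwiner (hT : ∀ b c : BoundaryPath G, TailEquiv b c)
    (hC : ∀ (b : BoundaryPath G) {m : ℕ}, 0 < m → (∀ i < m, (b.1 i).2 ≠ none) →
      (b.drop m).src ≠ b.src)
    (hS : ∀ v, G.IsSingular v → ∀ e, G.s e ≠ v)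
    {ω : BoundaryPath G} (hω : ∀ c : BoundaryPath G, c.src = ω.src → c = ω) :
    ∃ Φ : (BoundaryPath G →₀ k) →ₗ[k] LeavittPathAlgebra k G,
      Φ (Finsupp.single ω 1) = .p ω.src ∧ ∀ a f, Φ (pathRep k G (1 : kˣ) a f) = a * Φ f := by
  obtain ⟨y, hyω, hyp, hys⟩ := exists_basis_lift (k := k) hT hC hω
  let Φ := Finsupp.linearCombination k y
  have hΦ : ∀ b, Φ (Finsupp.single b 1) = y b := fun b => by
    rw [Finsupp.linearCombination_single, one_smul]
  have gen : ∀ (T : Module.End k (BoundaryPath G →₀ k)) (a : LeavittPathAlgebra k G),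
      (∀ b, Φ (T (Finsupp.single b 1)) = a * y b) → ∀ f, Φ (T f) = a * Φ f := by
    intro T a h f
    induction f using Finsupp.induction_linear with
    | zero => simp
    | add f g hf hg => rw [map_add, map_add, hf, hg, map_add, mul_add]
    | single b c =>
      rw [← mul_one c, ← smul_eq_mul, ← Finsupp.smul_single, map_smul, map_smul, h, map_smul,
        hΦ, mul_smul_comm]
  refine ⟨Φ, (hΦ ω).trans hyω, fun a f => ?_⟩
  induction a using LeavittPathAlgebra.induction generalizing f with
  | hp v =>
    rw [pathRep_p]
    refine gen _ _ (fun b => ?_) f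
    by_cases h : b.src = v
    · rw [vertexOp_single_of_eq h, hΦ, ← h, hyp]
    · rw [vertexOp_single_of_ne h, map_zero, ← hyp, ← mul_assoc,
        LeavittPathAlgebra.p_mul_p_of_ne (Ne.symm h), zero_mul]
  | hs e =>
    rw [pathRep_s]
    refine gen _ _ (fun b => ?_) f
    by_cases h : b.src = G.r e
    · rw [edgeOp_single_of_eq h, Units.val_one, one_mul, hΦ, ← hys _ e (head_cons e b h),
        tail_cons]
    · rw [edgeOp_single_of_ne h, map_zero, ← hyp, ← LeavittPathAlgebra.s_mul_p, mul_assoc,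
        ← mul_assoc (LeavittPathAlgebra.p _), LeavittPathAlgebra.p_mul_p_of_ne (Ne.symm h),
        zero_mul, mul_zero]
  | hsStar e =>
    rw [pathRep_sStar]
    refine gen _ _ (fun b => ?_) f
    by_cases h : b.head = some e
    · rw [edgeStarOp_single_of_eq h, inv_one, Units.val_one, one_mul, hΦ, ← hys b e h, ← mul_assoc,
        LeavittPathAlgebra.sStar_mul_s, ← src_tail h, hyp]
    · rw [edgeStarOp_single_of_ne h, map_zero]
      rcases hb : b.head with _ | f
      · rw [← hyp, ← LeavittPathAlgebra.sStar_mul_p, mul_assoc,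
          ← mul_assoc (LeavittPathAlgebra.p _),
          LeavittPathAlgebra.p_mul_p_of_ne (hS _ (isSingular_src hb) e), zero_mul, mul_zero]
      · rw [← hys b f hb, ← mul_assoc, LeavittPathAlgebra.sStar_mul_s_of_ne, zero_mul]
        rintro rfl
        exact h hb
  | hzero => rw [map_zero, LinearMap.zero_apply, map_zero, zero_mul]
  | hadd a a' iha ihb => rw [map_add, LinearMap.add_apply, map_add, iha, ihb, add_mul]
  | hmul a a' iha ihb => rw [map_mul, Module.End.mul_apply, iha, ihb, mul_assoc]
  | hsmul c a ih => rw [map_smul, LinearMap.smul_apply, map_smul, ih, smul_mul_assoc]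

/-- The two-sided ideal generated by `p_w`, for any vertex `w`, is everything: it contains `p_v` for
the vertices `v` on a boundary path starting at `w`, and then for all `v`, by the relations
`p_v = ∑ s_e s_e^*` and well-founded induction. -/
theorem mem_of_p_mem (hT : ∀ b c : BoundaryPath G, TailEquiv b c) (ω : BoundaryPath G)
    (I : Submodule k (LeavittPathAlgebra k G)) (hl : ∀ x y, y ∈ I → x * y ∈ I)
    (hr : ∀ x y, x ∈ I → x * y ∈ I) (hp : .p ω.src ∈ I) (a : LeavittPathAlgebra k G) : a ∈ I := by
  have h₁ : ∀ n, .p (ω.drop n).src ∈ I := by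
    intro n
    induction n with
    | zero => exact hp
    | succ n ih =>
      rw [← tail_drop]
      rcases hh : (ω.drop n).head with _ | e
      · rwa [tail, drop_of_head_eq_none hh]
      · rw [src_tail hh, ← LeavittPathAlgebra.sStar_mul_s, ← LeavittPathAlgebra.p_mul_s,
          s_of_head hh]
        exact hl _ _ (hr _ _ ih)
  have h₂ : ∀ v, .p v ∈ I := by
    intro v
    induction v using (wellFounded_edge hT ω).induction with
    | _ v ih =>
      by_cases hv : ∃ n, (ω.drop n).src = v
      · obtain ⟨n, rfl⟩ := hv
        exact h₁ n
      · have hreg : ∃ F : Finset E, F.Nonempty ∧ ∀ e, e ∈ F ↔ G.s e = v := by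
          by_contra hsing
          obtain ⟨m, n, h⟩ := hT (const hsing) ω
          exact hv ⟨n, by rw [← h]; rfl⟩
        obtain ⟨F, hF, hFv⟩ := hreg
        rw [LeavittPathAlgebra.p_eq_sum hF hFv]
        refine Submodule.sum_mem _ fun e he => ?_
        rw [← LeavittPathAlgebra.p_mul_sStar]
        exact hl _ _ (hr _ _ (ih _ ⟨not_exists.1 hv, e, (hFv e).1 he, rfl⟩))
  induction a using LeavittPathAlgebra.induction with
  | hp v => exact h₂ v
  | hs e =>
    rw [← LeavittPathAlgebra.p_mul_s]
    exact hr _ _ (h₂ _)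
  | hsStar e =>
    rw [← LeavittPathAlgebra.p_mul_sStar]
    exact hr _ _ (h₂ _)
  | hzero => exact I.zero_mem
  | hadd a b iha ihb => exact I.add_mem iha ihb
  | hmul a b _ ihb => exact hl _ _ ihb
  | hsmul c a ih => exact I.smul_mem c ih

theorem eq_zero_of_pathRep_eq_zero (hT : ∀ b c : BoundaryPath G, TailEquiv b c)
    (hC : ∀ (b : BoundaryPath G) {m : ℕ}, 0 < m → (∀ i < m, (b.1 i).2 ≠ none) →
      (b.drop m).src ≠ b.src)
    (hS : ∀ v, G.IsSingular v → ∀ e, G.s e ≠ v)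
    {ω : BoundaryPath G} (hω : ∀ c : BoundaryPath G, c.src = ω.src → c = ω)
    {a : LeavittPathAlgebra k G} (ha : pathRep k G (1 : kˣ) a = 0) : a = 0 := by
  obtain ⟨Φ, hΦω, hΦ⟩ := exists_intertwiner (k := k) hT hC hS hω
  -- The right annihilator of the kernel is a two-sided ideal that contains `p_w`.
  let I : Submodule k (LeavittPathAlgebra k G) :=
    { carrier := {x | ∀ a, pathRep k G (1 : kˣ) a = 0 → a * x = 0}
      add_mem' := fun {x y} hx hy a ha => by rw [mul_add, hx a ha, hy a ha, add_zero]
      zero_mem' := fun a _ => mul_zero a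
      smul_mem' := fun c x hx a ha => by rw [mul_smul_comm, hx a ha, smul_zero] }
  refine LeavittPathAlgebra.eq_zero_of_mul_eq_zero fun b =>
    mem_of_p_mem hT ω I (fun x y hy a ha => ?_) (fun x y hx a ha => ?_) (fun a ha => ?_) b a ha
  · rw [← mul_assoc]
    exact hy _ (by rw [map_mul, ha, zero_mul])
  · rw [← mul_assoc, hx a ha, zero_mul]
  · rw [← hΦω, ← hΦ, ha, LinearMap.zero_apply, map_zero]

/-! ### The matrix of an element -/

/-- The matrix entries of an element in the untwisted representation on boundary paths. -/
noncomputable def pathEntry (a : LeavittPathAlgebra k G) (b c : BoundaryPath G) : k :=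
  pathRep k G (1 : kˣ) a (Finsupp.single c 1) b

theorem pathEntry_mul (a a' : LeavittPathAlgebra k G) (b c : BoundaryPath G) :
    pathEntry (a * a') b c = ∑ᶠ d, pathEntry a b d * pathEntry a' d c := by
  set f := pathRep k G (1 : kˣ) a' (Finsupp.single c 1) with hf
  have hd : ∀ d, pathEntry a' d c = f d := fun d => rfl
  rw [finsum_eq_sum_of_support_subset (s := f.support) _ fun d h => by
    simpa [hd] using right_ne_zero_of_mul h]
  rw [pathEntry, map_mul, Module.End.mul_apply, ← hf]
  conv_lhs => rw [← Finsupp.sum_single f, map_finsuppSum]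
  rw [Finsupp.sum, Finsupp.finsetSum_apply]
  refine Finset.sum_congr rfl fun d _ => ?_
  rw [← mul_one (f d), ← smul_eq_mul, ← Finsupp.smul_single, map_smul, Finsupp.smul_apply,
    smul_eq_mul, mul_comm, hd]
  rfl

open scoped Classical in
theorem pathEntry_p (v : V) (b c : BoundaryPath G) :
    pathEntry (.p v : LeavittPathAlgebra k G) b c = if b.src = v ∧ b = c then 1 else 0 := by
  rw [pathEntry, pathRep_p]
  by_cases h : c.src = v
  · rw [vertexOp_single_of_eq h, Finsupp.single_apply]
    refine if_congr ⟨?_, fun h' => h'.2.symm⟩ rfl rfl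
    rintro rfl
    exact ⟨h, rfl⟩
  · rw [vertexOp_single_of_ne h, if_neg]
    · rfl
    · rintro ⟨h', rfl⟩
      exact h h'

open scoped Classical in
theorem pathEntry_s (e : E) (b c : BoundaryPath G) :
    pathEntry (.s e : LeavittPathAlgebra k G) b c =
      if b.head = some e ∧ b.tail = c then 1 else 0 := by
  rw [pathEntry, pathRep_s]
  by_cases h : c.src = G.r e
  · rw [edgeOp_single_of_eq h, Units.val_one, one_mul, Finsupp.single_apply]
    refine if_congr ⟨?_, ?_⟩ rfl rfl
    · rintro rfl
      exact ⟨rfl, rfl⟩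
    · rintro ⟨h', rfl⟩
      exact cons_tail h'
  · rw [edgeOp_single_of_ne h, if_neg]
    · rfl
    · rintro ⟨h', rfl⟩
      exact h (src_tail h')

open scoped Classical in
theorem pathEntry_sStar (e : E) (b c : BoundaryPath G) :
    pathEntry (.sStar e : LeavittPathAlgebra k G) b c =
      if c.head = some e ∧ c.tail = b then 1 else 0 := by
  rw [pathEntry, pathRep_sStar]
  by_cases h : c.head = some e
  · rw [edgeStarOp_single_of_eq h, inv_one, Units.val_one, one_mul, Finsupp.single_apply]
    exact if_congr ⟨fun h' => ⟨h, h'⟩, fun h' => h'.2⟩ rfl rfl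
  · rw [edgeStarOp_single_of_ne h, if_neg fun h' => h h'.1]
    rfl

theorem pathEntry_star [StarRing k] (a : LeavittPathAlgebra k G) (b c : BoundaryPath G) :
    pathEntry (star a) b c = star (pathEntry a c b) := by
  classical
  induction a using LeavittPathAlgebra.induction generalizing b c with
  | hp v =>
    rw [LeavittPathAlgebra.star_p, pathEntry_p, pathEntry_p, apply_ite star, star_one, star_zero]
    refine if_congr ⟨?_, ?_⟩ rfl rfl <;>
    · rintro ⟨h, rfl⟩
      exact ⟨h, rfl⟩
  | hs e =>
    rw [LeavittPathAlgebra.star_s, pathEntry_s, pathEntry_sStar, apply_ite star, star_one,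
      star_zero]
  | hsStar e =>
    rw [LeavittPathAlgebra.star_sStar, pathEntry_s, pathEntry_sStar, apply_ite star, star_one,
      star_zero]
  | hzero => simp [pathEntry]
  | hadd a a' iha ihb =>
    have h₁ := iha b c
    have h₂ := ihb b c
    simp only [pathEntry, star_add, map_add, LinearMap.add_apply, Finsupp.add_apply] at h₁ h₂ ⊢
    rw [h₁, h₂]
  | hmul a a' iha ihb =>
    rw [star_mul, pathEntry_mul, pathEntry_mul]
    simp only [iha, ihb, ← star_mul]
    exact ((starAddEquiv (R := k)).map_finsum _).symm
  | hsmul r a ih =>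
    have h₁ := ih b c
    simp only [pathEntry, star_smul, map_smul, LinearMap.smul_apply, Finsupp.smul_apply] at h₁ ⊢
    rw [h₁]

theorem finite_pathEntry_ne_zero [StarRing k] (hT : ∀ b c : BoundaryPath G, TailEquiv b c)
    {ω : BoundaryPath G} (hω : ∀ c : BoundaryPath G, c.src = ω.src → c = ω)
    (a : LeavittPathAlgebra k G) :
    {q : BoundaryPath G × BoundaryPath G | pathEntry a q.1 q.2 ≠ 0}.Finite := by
  classical
  let I : Submodule k (LeavittPathAlgebra k G) :=
    { carrier := {a | {q : BoundaryPath G × BoundaryPath G | pathEntry a q.1 q.2 ≠ 0}.Finite}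
      add_mem' := fun {x y} hx hy => (Set.Finite.union hx hy).subset fun q hq => by
        by_contra hc
        rw [Set.mem_union, not_or] at hc
        refine hq ?_
        have h₁ : pathEntry x q.1 q.2 = 0 := not_not.1 hc.1
        have h₂ : pathEntry y q.1 q.2 = 0 := not_not.1 hc.2
        rw [pathEntry] at h₁ h₂ ⊢
        rw [map_add, LinearMap.add_apply, Finsupp.add_apply, h₁, h₂, add_zero]
      zero_mem' := by simp [pathEntry]
      smul_mem' := fun c x hx => Set.Finite.subset hx fun q hq h => by
        refine hq ?_
        rw [pathEntry] at h ⊢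
        rw [map_smul, LinearMap.smul_apply, Finsupp.smul_apply, h, smul_zero] }
  have hl : ∀ x y, y ∈ I → x * y ∈ I := by
    intro x y hy
    refine (Set.Finite.biUnion
      (s := {q : BoundaryPath G × BoundaryPath G | pathEntry y q.1 q.2 ≠ 0}) hy
      (t := fun q => (fun b => (b, q.2)) ''
        ((pathRep k G (1 : kˣ) x (Finsupp.single q.1 1)).support : Set (BoundaryPath G)))
      fun q _ => (Finset.finite_toSet _).image _).subset ?_
    rintro ⟨b, c⟩ h
    obtain ⟨d, hd⟩ : ∃ d, pathEntry x b d * pathEntry y d c ≠ 0 := by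
      by_contra hc
      push Not at hc
      refine h ?_
      change pathEntry (x * y) b c = 0
      rw [pathEntry_mul, finsum_eq_zero_of_forall_eq_zero hc]
    exact Set.mem_biUnion (x := (d, c)) (right_ne_zero_of_mul hd)
      ⟨b, Finsupp.mem_support_iff.2 (left_ne_zero_of_mul hd), rfl⟩
  have hstar : ∀ x, x ∈ I → star x ∈ I := by
    intro x hx
    refine (Set.Finite.image Prod.swap hx).subset fun q hq => ⟨q.swap, fun h => hq ?_, q.swap_swap⟩
    change pathEntry (star x) q.1 q.2 = 0
    rw [pathEntry_star, show pathEntry x q.2 q.1 = 0 from h, star_zero]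
  refine mem_of_p_mem hT ω I hl (fun x y hx => ?_) ?_ a
  · have := hstar _ (hl (star y) _ (hstar x hx))
    rwa [star_mul, star_star, star_star] at this
  · refine (Set.finite_singleton (ω, ω)).subset fun q hq => ?_
    have hq' : pathEntry (.p ω.src : LeavittPathAlgebra k G) q.1 q.2 ≠ 0 := hq
    rw [pathEntry_p] at hq'
    obtain ⟨h₁, h₂⟩ : q.1.src = ω.src ∧ q.1 = q.2 := by
      by_contra hc
      exact hq' (if_neg hc)
    exact Prod.ext (hω _ h₁) (h₂.symm.trans (hω _ h₁))

theorem exists_pathRep_eq_single (hT : ∀ b c : BoundaryPath G, TailEquiv b c)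
    (ω b : BoundaryPath G) :
    ∃ x : LeavittPathAlgebra k G,
      pathRep k G (1 : kˣ) x (Finsupp.single ω 1) = Finsupp.single b 1 := by
  obtain ⟨m, n, h⟩ := hT ω b
  have h₁ : ∃ x : LeavittPathAlgebra k G,
      pathRep k G (1 : kˣ) x (Finsupp.single ω 1) = Finsupp.single (ω.drop m) 1 := by
    clear h
    induction m with
    | zero => exact ⟨.p ω.src, by rw [pathRep_p, vertexOp_single_of_eq rfl, drop_zero]⟩
    | succ m ih =>
      obtain ⟨x, hx⟩ := ih
      rw [← tail_drop]
      rcases hh : (ω.drop m).head with _ | e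
      · exact ⟨x, by rw [hx, tail, drop_of_head_eq_none hh]⟩
      · exact ⟨.sStar e * x, by
          rw [map_mul, Module.End.mul_apply, hx, pathRep_sStar, edgeStarOp_single_of_eq hh, inv_one,
            Units.val_one, one_mul]⟩
  rw [h] at h₁
  clear h
  induction n with
  | zero => exact h₁
  | succ n ih =>
    refine ih ?_
    obtain ⟨x, hx⟩ := h₁
    rw [← tail_drop] at hx
    rcases hh : (b.drop n).head with _ | e
    · rw [tail, drop_of_head_eq_none hh] at hx
      exact ⟨x, hx⟩
    · refine ⟨.s e * x, ?_⟩
      rw [map_mul, Module.End.mul_apply, hx, pathRep_s, edgeOp_single_of_eq (src_tail hh),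
        cons_tail hh, Units.val_one, one_mul]

open scoped Classical in
/-- All matrix units are matrices of elements of `L_k(G)`. -/
theorem exists_pathEntry_eq_ite [StarRing k] (hT : ∀ b c : BoundaryPath G, TailEquiv b c)
    {ω : BoundaryPath G} (hω : ∀ c : BoundaryPath G, c.src = ω.src → c = ω)
    (b c : BoundaryPath G) :
    ∃ x : LeavittPathAlgebra k G, ∀ i j, pathEntry x i j = if i = b ∧ j = c then 1 else 0 := by
  have key : ∀ b : BoundaryPath G, ∃ x : LeavittPathAlgebra k G,
      ∀ i j, pathEntry x i j = if i = b ∧ j = ω then 1 else 0 := by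
    intro b
    obtain ⟨x, hx⟩ := exists_pathRep_eq_single (k := k) hT ω b
    refine ⟨x * .p ω.src, fun i j => ?_⟩
    rw [pathEntry, map_mul, Module.End.mul_apply, pathRep_p]
    by_cases hj : j = ω
    · rw [hj, vertexOp_single_of_eq rfl, hx, Finsupp.single_apply]
      exact if_congr ⟨fun h => ⟨h.symm, rfl⟩, fun h => h.1.symm⟩ rfl rfl
    · rw [vertexOp_single_of_ne fun h => hj (hω j h), map_zero, if_neg fun h => hj h.2]
      rfl
  obtain ⟨x, hx⟩ := key b
  obtain ⟨y, hy⟩ := key c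
  refine ⟨x * star y, fun i j => ?_⟩
  rw [pathEntry_mul, finsum_eq_single _ ω]
  · rw [pathEntry_star, hx, hy]
    by_cases hi : i = b <;> by_cases hj : j = c <;> simp [hi, hj]
  · intro d hd
    rw [hx, if_neg fun h => hd h.2, zero_mul]

/-- If all boundary paths are tail equivalent, there are no closed paths, and `ω` is the only
boundary path with its source, then `L_k(G)` is the algebra of finitely supported matrices indexed
by the boundary paths. -/
theorem nonempty_starAlgEquiv [StarRing k] (hT : ∀ b c : BoundaryPath G, TailEquiv b c)
    (hC : ∀ (b : BoundaryPath G) {m : ℕ}, 0 < m → (∀ i < m, (b.1 i).2 ≠ none) →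
      (b.drop m).src ≠ b.src)
    {ω : BoundaryPath G} (hω : ∀ c : BoundaryPath G, c.src = ω.src → c = ω) :
    Nonempty (LeavittPathAlgebra k G ≃⋆ₐ[k] FinSuppMatrix (BoundaryPath G) k) := by
  classical
  let φ : LeavittPathAlgebra k G →⋆ₙₐ[k] FinSuppMatrix (BoundaryPath G) k :=
    { toFun := fun a => .ofEntries (pathEntry a) (finite_pathEntry_ne_zero hT hω a)
      map_smul' := fun c a => by
        ext i j
        simp [pathEntry]
      map_zero' := by
        ext i j
        simp [pathEntry]
      map_add' := fun a b => by
        ext i j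
        simp [pathEntry]
      map_mul' := fun a b => by
        ext i j
        exact pathEntry_mul a b i j
      map_star' := fun a => by
        ext i j
        exact pathEntry_star a i j }
  have hφ : ∀ a i j, (φ a).entry i j = pathEntry a i j := fun _ _ _ => rfl
  refine ⟨StarAlgEquiv.ofBijective φ ⟨?_, ?_⟩⟩
  · rw [injective_iff_map_eq_zero]
    intro a ha
    refine eq_zero_of_pathRep_eq_zero hT hC (fun v hv => s_ne_of_isSingular hT hC hv) hω ?_
    refine Finsupp.lhom_ext fun c κ => Finsupp.ext fun b => ?_
    have h := hφ a b c
    rw [ha, FinSuppMatrix.entry_zero] at h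
    rw [← mul_one κ, ← smul_eq_mul, ← Finsupp.smul_single, map_smul, Finsupp.smul_apply,
      show pathRep k G (1 : kˣ) a (Finsupp.single c 1) b = 0 from h.symm]
    simp
  · intro M
    refine Finsupp.induction_linear (motive := fun M => ∃ a, φ a = M) M ⟨0, map_zero φ⟩ ?_ ?_
    · rintro _ _ ⟨a, rfl⟩ ⟨b, rfl⟩
      exact ⟨a + b, map_add φ a b⟩
    · rintro ⟨b, c⟩ κ
      obtain ⟨x, hx⟩ := exists_pathEntry_eq_ite (k := k) hT hω b c
      refine ⟨κ • x, FinSuppMatrix.ext fun i j => ?_⟩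
      rw [map_smul, FinSuppMatrix.entry_smul, hφ, hx]
      change _ = Finsupp.single (b, c) κ (i, j)
      rw [Finsupp.single_apply, mul_ite, mul_one, mul_zero]
      exact if_congr (by rw [Prod.mk.injEq, eq_comm, eq_comm (a := j)]) rfl rfl

end BoundaryPath

theorem mainTheorem6 {k : Type w} [Field k] [StarRing k] {V : Type u} {E : Type v}
    (G : DiGraph V E)
    (h : ∀ (V₁ V₂ : Type (max u v w)) [AddCommGroup V₁] [Module k V₁]
      [AddCommGroup V₂] [Module k V₂]
      (ρ₁ : LeavittPathAlgebra k G →ₙₐ[k] Module.End k V₁)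
      (ρ₂ : LeavittPathAlgebra k G →ₙₐ[k] Module.End k V₂),
      IsIrreducibleRep ρ₁ → IsIrreducibleRep ρ₂ → AlgebraicallyEquivalent ρ₁ ρ₂) :
    ∃ Λ : Type (max u v), Nonempty (LeavittPathAlgebra k G ≃⋆ₐ[k] FinSuppMatrix Λ k) := by
  have hU : HasUniqueIrreducibleRep k (LeavittPathAlgebra k G) := h
  have hT : ∀ b c : BoundaryPath G, b.TailEquiv c := BoundaryPath.tailEquiv_of_unique hU
  have hC : ∀ (b : BoundaryPath G) {m : ℕ}, 0 < m → (∀ i < m, (b.1 i).2 ≠ none) →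
      (b.drop m).src ≠ b.src :=
    BoundaryPath.src_drop_ne_of_forall_drop_ne fun b n => BoundaryPath.drop_ne_self_of_unique hU
  refine ⟨BoundaryPath G, ?_⟩
  rcases isEmpty_or_nonempty V with hV | ⟨⟨v⟩⟩
  · -- Without vertices there are no edges either, and both algebras are zero.
    have : IsEmpty E := ⟨fun e => hV.false (G.s e)⟩
    have h0 : ∀ a : LeavittPathAlgebra k G, a = 0 := fun a =>
      LeavittPathAlgebra.eq_zero_of_mul_eq_zero fun b => by
        obtain ⟨F, hF⟩ := LeavittPathAlgebra.exists_mul_sum_p_eq b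
        rw [← hF F subset_rfl, Finset.eq_empty_of_isEmpty F, Finset.sum_empty, mul_zero, mul_zero]
    let φ : LeavittPathAlgebra k G →⋆ₙₐ[k] FinSuppMatrix (BoundaryPath G) k := 0
    exact ⟨StarAlgEquiv.ofBijective φ ⟨fun a b _ => (h0 a).trans (h0 b).symm,
      fun M => ⟨0, FinSuppMatrix.ext fun i => (hV.false i.src).elim⟩⟩⟩
  · obtain ⟨b, -⟩ := BoundaryPath.exists_src_eq (G := G) v
    have : Nonempty (BoundaryPath G) := ⟨b⟩
    obtain ⟨ω, hω⟩ := BoundaryPath.exists_forall_src_eq hT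
      fun v hv => BoundaryPath.s_ne_of_isSingular hT hC hv
    exact BoundaryPath.nonempty_starAlgEquiv hT hC hω
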